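/- Let $\mathcal H=(\mathbb C^d)^{\otimes n}$ be the space of $n$ qudits. The symmetric group $S_n$ acts on $\mathcal H$ by permuting the qudits; let $p(n,d)$ be the number of inequivalent irreducible representations of $S_n$ occurring in $\mathcal H$, and call the corresponding isotypic components of $\mathcal H$ the charge sectors. An operator on $\mathcal H$ is $SU(d)$-symmetric if it commutes with $V^{\otimes n}$ for all $V\in SU(d)$; let $\mathcal H_\times$ be the compact group of $SU(d)$-symmetric unitaries on $\mathcal H$. A relative phase matrix is an element of $\mathcal H_\times$ that acts as a scalar on each charge sector. An element of $\mathcal H_\times$ has locality $\gamma$ if it acts nontrivially on at most $\gamma$ qudits, or if it equals $e^{-iH}$ for an $SU(d)$-symmetric Hermitian $H$ that is a sum of operators each acting on at most $\gamma$ qudits. Let $G_\gamma\subseteq\mathcal H_\times$ be the closed subgroup generated by the elements of locality $\gamma$ (all circuits of such gates, and their limits). An ensemble of locality $\gamma$ is a Borel probability measure $\nu$ on $\mathcal H_\times$ (finitely or infinitely supported) with $\nu(G_\gamma)=1$. Its $k$-fold twirling channel is $T_k^\nu(M)=\int U^{\otimes k}MU^{\dagger\otimes k}\,d\nu(U)$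 for $M\in\operatorname{End}(\mathcal H^{\otimes k})$, and $T_k^{\mathrm{Haar}}$ is the one for the Haar probability measure of $\mathcal H_\times$. After $s$ steps, $\nu$ is an $\epsilon$-approximate $SU(d)$-symmetric $k$-design if $\|(T_k^\nu)^s-T_k^{\mathrm{Haar}}\|_\diamond\le\epsilon/d^{nk}$ (diamond norm). We say that locality $\gamma$ excludes large designs on $n$ qudits if there is $k_0$ such that for every $k\ge k_0$ there is $\epsilon>0$ such that no ensemble of locality $\gamma$ is, after any number $s\ge 0$ of steps, an $\epsilon$-approximate $SU(d)$-symmetric $k$-design. 1. There is a universal constant $c>0$ such that for all $n,d,\gamma\ge 0$: (a) if $G_\gamma$ contains all relative phase matrices, then $\gamma\ge c\log p(n,d)$; (b) if $\gamma<c\log p(n,d)$, then locality $\gamma$ excludes large designs on $n$ qudits. 2. For every $d\ge 2$ and every $\gamma$ there is $n_0$ such that, for all $n\ge n_0$, locality $\gamma$ excludes large designs on $n$ qudits. That is, no ensemble of $SU(d)$-symmetric unitaries of bounded locality, finite or infinite, approximates the $SU(d)$-symmetric $k$-design for arbitrarily large $k$. -/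

import Mathlib

open MeasureTheory
open scoped ENNReal Matrix

noncomputable section

namespace SymDesign

/-- The tensor power `A^{⊗ k}` of a matrix; the basis of the `k`-fold tensor power of `ℂ^ι`
is indexed by `Fin k → ι`. -/
def tensorPow {ι : Type} (k : ℕ) (A : Matrix ι ι ℂ) :
    Matrix (Fin k → ι) (Fin k → ι) ℂ :=
  Matrix.of fun x y => ∏ i, A (x i) (y i)

/-- The computational basis of `n` qudits of local dimension `d`. -/
abbrev Idx (n d : ℕ) : Type := Fin n → Fin d

/-- `SU(d)` symmetry of an operator on `n` qudits: it commutes with `V^{⊗ n}` for all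
`V ∈ SU(d)`. -/
def IsSymmetric {n d : ℕ} (A : Matrix (Idx n d) (Idx n d) ℂ) : Prop :=
  ∀ V ∈ Matrix.specialUnitaryGroup (Fin d) ℂ, Commute A (tensorPow n V)

lemma isSymmetric_star {n d : ℕ} {A : Matrix (Idx n d) (Idx n d) ℂ} (hA : IsSymmetric A) :
    IsSymmetric (star A) := by
  intro V hV
  have hV' : star V ∈ Matrix.specialUnitaryGroup (Fin d) ℂ := by
    rw [Matrix.mem_specialUnitaryGroup_iff] at hV ⊢
    exact ⟨Unitary.star_mem hV.1, by
      rw [Matrix.star_eq_conjTranspose, Matrix.det_conjTranspose, hV.2, star_one]⟩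
  have h := (commute_star_star (x := A)).2 (hA (star V) hV')
  have e : star (tensorPow n (star V)) = tensorPow n V := by
    ext x y
    simp [tensorPow, Matrix.star_apply]
  rwa [e] at h

/-- The group of `SU(d)`-symmetric unitaries on `n` qudits. -/
def symUnitary (n d : ℕ) : Subgroup (Matrix.unitaryGroup (Idx n d) ℂ) where
  carrier := {U | IsSymmetric (U : Matrix (Idx n d) (Idx n d) ℂ)}
  one_mem' := fun _ _ => Commute.one_left _
  mul_mem' := fun {_ _} hU hW V hV => (hU V hV).mul_left (hW V hV)
  inv_mem' := fun {_} hU => isSymmetric_star hU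

/-- The compact group of `SU(d)`-symmetric unitaries, as a type. -/
abbrev SymU (n d : ℕ) : Type := ↥(symUnitary n d)

/-- The matrix of a symmetric unitary. -/
def SymU.mat {n d : ℕ} (U : SymU n d) : Matrix (Idx n d) (Idx n d) ℂ :=
  ((U : Matrix.unitaryGroup (Idx n d) ℂ) : Matrix (Idx n d) (Idx n d) ℂ)

lemma SymU.continuous_mat {n d : ℕ} : Continuous (SymU.mat : SymU n d → _) :=
  continuous_subtype_val.comp continuous_subtype_val

instance (n d : ℕ) : CompactSpace (SymU n d) := by
  have hcl : IsClosed {A : Matrix (Idx n d) (Idx n d) ℂ |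
      A ∈ Matrix.unitaryGroup (Idx n d) ℂ ∧ IsSymmetric A} := by
    have h1 : IsClosed {A : Matrix (Idx n d) (Idx n d) ℂ |
        A ∈ Matrix.unitaryGroup (Idx n d) ℂ} := isClosed_unitary
    have h2 : IsClosed {A : Matrix (Idx n d) (Idx n d) ℂ | IsSymmetric A} := by
      simp only [IsSymmetric, Commute, SemiconjBy, Set.ofPred_forall]
      exact isClosed_iInter fun V => isClosed_iInter fun _ =>
        isClosed_eq (by fun_prop) (by fun_prop)
    exact h1.inter h2
  have hK : IsCompact (Set.pi Set.univ fun _ : Idx n d => Set.pi Set.univ fun _ : Idx n d =>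
      Metric.closedBall (0 : ℂ) 1) :=
    isCompact_univ_pi fun _ => isCompact_univ_pi fun _ => isCompact_closedBall 0 1
  have hc : IsCompact {A : Matrix (Idx n d) (Idx n d) ℂ |
      A ∈ Matrix.unitaryGroup (Idx n d) ℂ ∧ IsSymmetric A} := by
    refine hK.of_isClosed_subset hcl ?_
    rintro A ⟨hA, -⟩ i - j -
    simpa using entry_norm_bound_of_unitary hA i j
  have hind : Topology.IsInducing (SymU.mat : SymU n d → _) :=
    Topology.IsInducing.subtypeVal.comp Topology.IsInducing.subtypeVal
  refine ⟨hind.isCompact_iff.2 ?_⟩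
  convert hc
  ext A
  constructor
  · rintro ⟨U, -, rfl⟩
    exact ⟨U.1.2, U.2⟩
  · rintro ⟨h1, h2⟩
    exact ⟨⟨⟨A, h1⟩, h2⟩, trivial, rfl⟩

instance (n d : ℕ) : MeasurableSpace (SymU n d) := borel _

instance (n d : ℕ) : BorelSpace (SymU n d) := ⟨rfl⟩

/-- The Haar probability measure on the group of symmetric unitaries. -/
def haarSym (n d : ℕ) : Measure (SymU n d) := Measure.haarMeasure ⊤

instance (n d : ℕ) : IsProbabilityMeasure (haarSym n d) :=
  ⟨by simpa [haarSym] using Measure.haarMeasure_self (G := SymU n d) (K₀ := ⊤)⟩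

/-! ### Twirling channels, diamond norm, approximate designs -/

/-- The integrand `U^{⊗ k} M (U^{⊗ k})†` of the `k`-fold twirling channel. -/
def conjPow {n d : ℕ} (k : ℕ) (U : SymU n d)
    (M : Matrix (Fin k → Idx n d) (Fin k → Idx n d) ℂ) :
    Matrix (Fin k → Idx n d) (Fin k → Idx n d) ℂ :=
  tensorPow k U.mat * M * (tensorPow k U.mat)ᴴ

lemma integrable_conjPow {n d : ℕ} (ν : Measure (SymU n d)) [IsFiniteMeasure ν] (k : ℕ)
    (M : Matrix (Fin k → Idx n d) (Fin k → Idx n d) ℂ) (x y : Fin k → Idx n d) :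
    Integrable (fun U => conjPow k U M x y) ν := by
  have hT : Continuous fun U : SymU n d => tensorPow k U.mat := by
    refine continuous_matrix fun a b => ?_
    simp only [tensorPow, Matrix.of_apply]
    exact continuous_finsetProd _ fun i _ => SymU.continuous_mat.matrix_elem _ _
  have hc : Continuous fun U : SymU n d => conjPow k U M x y := by
    refine Continuous.matrix_elem ?_ x y
    unfold conjPow
    exact (hT.mul continuous_const).mul hT.matrix_conjTranspose
  simpa using hc.continuousOn.integrableOn_compact (μ := ν) isCompact_univ

/-- The `k`-fold twirling channel `M ↦ ∫ U^{⊗ k} M (U^{⊗ k})† dν(U)` (entrywise integral). -/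
def twirl {n d : ℕ} (ν : Measure (SymU n d)) [IsFiniteMeasure ν] (k : ℕ) :
    Module.End ℂ (Matrix (Fin k → Idx n d) (Fin k → Idx n d) ℂ) where
  toFun M := Matrix.of fun x y => ∫ U, conjPow k U M x y ∂ν
  map_add' M N := by
    ext x y
    have h : ∀ U, conjPow k U (M + N) x y = conjPow k U M x y + conjPow k U N x y := by
      intro U
      simp [conjPow, mul_add, add_mul]
    simp only [Matrix.of_apply, Matrix.add_apply, h]
    exact integral_add (integrable_conjPow ν k M x y) (integrable_conjPow ν k N x y)
  map_smul' c M := by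
    ext x y
    have h : ∀ U, conjPow k U (c • M) x y = c • conjPow k U M x y := by
      intro U
      simp [conjPow]
    simp only [Matrix.of_apply, Matrix.smul_apply, RingHom.id_apply, h]
    exact integral_smul c _

/-- The trace norm `tr √(A† A)`: the sum of the singular values. -/
def traceNorm {ι : Type} [Fintype ι] [DecidableEq ι] (A : Matrix ι ι ℂ) : ℝ :=
  ∑ i, √((Matrix.isHermitian_conjTranspose_mul_self A).eigenvalues i)

/-- `Φ ⊗ id_r`, where the second tensor factor is an ancilla of dimension `r`. -/
def ampliation {ι : Type} (Φ : Module.End ℂ (Matrix ι ι ℂ)) (r : ℕ)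
    (X : Matrix (ι × Fin r) (ι × Fin r) ℂ) : Matrix (ι × Fin r) (ι × Fin r) ℂ :=
  Matrix.of fun p q => Φ (Matrix.of fun x y => X (x, p.2) (y, q.2)) p.1 q.1

/-- The diamond norm of a superoperator, as a supremum in `[0, ∞]`. -/
def diamondNorm {ι : Type} [Fintype ι] [DecidableEq ι] (Φ : Module.End ℂ (Matrix ι ι ℂ)) :
    ℝ≥0∞ :=
  ⨆ (r : ℕ) (X : Matrix (ι × Fin r) (ι × Fin r) ℂ) (_ : traceNorm X ≤ 1),
    ENNReal.ofReal (traceNorm (ampliation Φ r X))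

/-- The random circuit that applies `s` independent samples from the ensemble `ν` is an
`ε`-approximate `SU(d)`-symmetric `k`-design. -/
def IsApproxDesign {n d : ℕ} (ν : Measure (SymU n d)) [IsFiniteMeasure ν] (s k : ℕ) (ε : ℝ) :
    Prop :=
  diamondNorm (twirl ν k ^ s - twirl (haarSym n d) k) ≤
    ENNReal.ofReal (ε / ((d : ℝ) ^ n) ^ k)

/-! ### Locality -/

/-- `A` acts only on the qudits in `S`: `A = B_S ⊗ 1` on the other qudits. -/
def ActsOn {n d : ℕ} (S : Finset (Fin n)) (A : Matrix (Idx n d) (Idx n d) ℂ) : Prop :=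
  ∃ B : Matrix (S → Fin d) (S → Fin d) ℂ, ∀ x y,
    A x y = if ∀ i, i ∉ S → x i = y i then B (fun i => x i) (fun i => y i) else 0

/-- Operators acting on at most `γ` qudits. -/
def IsLocal {n d : ℕ} (γ : ℕ) (A : Matrix (Idx n d) (Idx n d) ℂ) : Prop :=
  ∃ S : Finset (Fin n), S.card ≤ γ ∧ ActsOn S A

/-- `SU(d)`-symmetric `γ`-local Hamiltonians: Hermitian symmetric sums of operators each of
which acts on at most `γ` qudits. -/
def IsLocalHamiltonian {n d : ℕ} (γ : ℕ) (H : Matrix (Idx n d) (Idx n d) ℂ) : Prop :=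
  H.IsHermitian ∧ IsSymmetric H ∧ H ∈ Submodule.span ℂ {A | IsLocal γ A}

/-- `SU(d)`-symmetric unitaries of locality `γ`: those acting on at most `γ` qudits, and the time
evolutions of `SU(d)`-symmetric `γ`-local Hamiltonians. -/
def localGates (n d γ : ℕ) : Set (SymU n d) :=
  {U | IsLocal γ U.mat ∨
    ∃ H, IsLocalHamiltonian γ H ∧ U.mat = NormedSpace.exp ((-Complex.I) • H)}

/-- The closed group generated by the symmetric unitaries of locality `γ`: all circuits of such
gates and their limits. -/
def localGroup (n d γ : ℕ) : Subgroup (SymU n d) :=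
  (Subgroup.closure (localGates n d γ)).topologicalClosure

/-! ### Charge sectors and relative phases -/

/-- The action of `S_n` on `n` qudits, `σ |i_1, …, i_n⟩ = |i_{σ⁻¹(1)}, …, i_{σ⁻¹(n)}⟩`. -/
def permRep (n d : ℕ) : Representation ℂ (Equiv.Perm (Fin n)) (Idx n d → ℂ) where
  toFun σ :=
    { toFun := fun f x => f (x ∘ σ)
      map_add' := fun _ _ => rfl
      map_smul' := fun _ _ => rfl }
  map_one' := rfl
  map_mul' _ _ := rfl

/-- The charge sectors: the isotypic components (an `S_n` irrep together with all its copies) of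
the `n`-qudit space. -/
def sectors (n d : ℕ) :
    Set (Submodule (MonoidAlgebra ℂ (Equiv.Perm (Fin n))) (permRep n d).asModule) :=
  isotypicComponents (MonoidAlgebra ℂ (Equiv.Perm (Fin n))) (permRep n d).asModule

/-- `p(n,d)`, the number of inequivalent `S_n` irreps in the space of `n` qudits. -/
def numSectors (n d : ℕ) : ℕ := (sectors n d).ncard

/-- Relative phase matrices: unitaries that act as a scalar on each charge sector. -/
def IsRelativePhase {n d : ℕ} (U : SymU n d) : Prop :=
  ∀ C ∈ sectors n d, ∃ z : ℂ, ∀ v ∈ C,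
    U.mat *ᵥ (permRep n d).asModuleEquiv v = z • (permRep n d).asModuleEquiv v

/-- For all large `k`, ensembles (probability measures) of unitaries from `localGroup n d γ`
stay at a fixed distance from the `SU(d)`-symmetric `k`-design, however many steps are taken. -/
def NoLargeDesigns (n d γ : ℕ) : Prop :=
  ∃ k₀ : ℕ, ∀ k ≥ k₀, ∃ ε > (0 : ℝ), ∀ (ν : Measure (SymU n d)) [IsProbabilityMeasure ν],
    (∀ᵐ U ∂ν, U ∈ localGroup n d γ) → ∀ s : ℕ, ¬ IsApproxDesign ν s k ε

end SymDesign

end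

open SymDesign

/-!
Words `x ∈ {1, …, d}ⁿ` are classified, up to renaming of letters and positions, by the partitions
of `n` into at most `d` parts. A symmetric unitary `U` is block diagonal for these word classes, so
integer weights `m` on the classes define a continuous character `χ_m U = ∏ det(U_c) ^ m c` of the
group of symmetric unitaries, with `χ_m (e^{-iH}) = exp (-i ∑ m(cls x) H_xx)`. There are at most
`2 ^ γ` partitions of `γ`, and summing `m` over the extensions of a word of length `γ` gives a
result that depends on the class of that word only; hence, when there are more than `2 ^ γ` word
classes, some `m ≠ 0` is orthogonal to all functions of `γ` letters, and `χ_m` is then trivial on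
all unitaries of locality `γ`. It is not trivial on the relative phases `e^{-itC}` with `C` a class
sum of `S_n`, because the traces `∑ m(cls x) C_xx` for the various `C` determine `m`.

For all large `k`, the character `χ_m` is moreover a weight of `U^{⊗ k} ⊗ Ū^{⊗ k}`, by means of
antisymmetric tensors: `U^{⊗ k} M (U^{⊗ k})† = χ_m(U) M` for some `M ≠ 0`. Every local twirl fixes
`M` while the Haar twirl kills it, so that no number of steps brings them closer.

An element of the center of `End_{S_n}(ℋ)` is determined by its diagonal, which is constant on word
classes; hence `p(n,d)` is at most the number of word classes.
-/

noncomputable section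

namespace SymDesign

/-! ### Words up to renaming of letters and positions -/

section Words

variable {α β : Type*}

lemma exists_perm_comp_eq [Fintype α] [DecidableEq β] {f g : α → β}
    (h : ∀ b, Fintype.card {a // f a = b} = Fintype.card {a // g a = b}) :
    ∃ σ : Equiv.Perm α, g ∘ σ = f :=
  ⟨Equiv.ofFiberEquiv fun b => Fintype.equivOfCardEq (h b),
    funext fun a => Equiv.ofFiberEquiv_map _ a⟩

lemma exists_perm_comp_eq_of_map_univ_eq [Fintype α] {f g : α → β}
    (h : Finset.univ.val.map f = Finset.univ.val.map g) : ∃ σ : Equiv.Perm α, g ∘ σ = f := by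
  classical
  refine exists_perm_comp_eq fun b => ?_
  have hb := congrArg (Multiset.count b) h
  simpa only [Multiset.count_map, ← Finset.filter_val, ← Finset.card_def, Fintype.card_subtype,
    eq_comm (a := b)] using hb

/-- Two words `α → β` are equivalent if they differ by a permutation of the alphabet `β` and a
permutation of the positions `α`. -/
def wordSetoid (α β : Type*) : Setoid (α → β) where
  r x y := ∃ (π : Equiv.Perm β) (σ : Equiv.Perm α), y = π ∘ x ∘ σ
  iseqv :=
    { refl := fun _ => ⟨1, 1, rfl⟩
      symm := by
        rintro x y ⟨π, σ, rfl⟩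
        exact ⟨π⁻¹, σ⁻¹, by ext i; simp⟩
      trans := by
        rintro x y z ⟨π, σ, rfl⟩ ⟨π', σ', rfl⟩
        exact ⟨π' * π, σ * σ', rfl⟩ }

/-- Words `α → β` up to renaming of letters and positions; equivalently, the partitions of `#α`
into at most `#β` parts. These classes play the role of the charge sectors. -/
def WordClass (α β : Type*) : Type _ := Quotient (wordSetoid α β)

/-- The class of a word. -/
def cls (x : α → β) : WordClass α β := Quotient.mk (wordSetoid α β) x

lemma cls_eq_cls {x y : α → β} :
    cls x = cls y ↔ ∃ (π : Equiv.Perm β) (σ : Equiv.Perm α), y = π ∘ x ∘ σ :=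
  Quotient.eq (r := wordSetoid α β)

lemma cls_comp (x : α → β) (π : Equiv.Perm β) (σ : Equiv.Perm α) : cls (π ∘ x ∘ σ) = cls x :=
  (cls_eq_cls.2 ⟨π, σ, rfl⟩).symm

lemma cls_surjective : Function.Surjective (cls : (α → β) → WordClass α β) :=
  Quotient.exists_rep

instance [Finite α] [Finite β] : Finite (WordClass α β) := by
  classical exact Quotient.finite _

instance [Fintype α] [Fintype β] : Fintype (WordClass α β) := Fintype.ofFinite _

instance : DecidableEq (WordClass α β) := Classical.decEq _

section LetterCount

variable [Fintype α] [DecidableEq β]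

/-- The number of occurrences of a letter in a word. -/
def letterCount (x : α → β) (b : β) : ℕ := Fintype.card {a // x a = b}

lemma letterCount_comp (x : α → β) (π : Equiv.Perm β) (σ : Equiv.Perm α) (b : β) :
    letterCount (π ∘ x ∘ σ) b = letterCount x (π.symm b) :=
  Fintype.card_congr <| σ.subtypeEquiv fun a => by
    simp only [Function.comp_apply, Equiv.eq_symm_apply]

lemma cls_eq_cls_iff_exists_letterCount {x y : α → β} :
    cls x = cls y ↔ ∃ π : Equiv.Perm β, letterCount y ∘ π = letterCount x := by
  refine ⟨fun h => ?_, fun ⟨π, hπ⟩ => ?_⟩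
  · obtain ⟨π, σ, rfl⟩ := cls_eq_cls.1 h
    exact ⟨π, funext fun b => by simp [letterCount_comp]⟩
  · have hcount (b : β) : letterCount (π ∘ x) b = letterCount y b := by
      rw [← Function.comp_id (π ∘ x)]
      simpa [← hπ] using letterCount_comp x π 1 b
    obtain ⟨σ, hσ⟩ := exists_perm_comp_eq fun b => (hcount b).symm
    exact cls_eq_cls.2 ⟨π, σ, hσ.symm⟩

variable [Fintype β]

lemma sum_letterCount (x : α → β) : ∑ b, letterCount x b = Fintype.card α := by
  simpa only [Fintype.card_sigma, letterCount] using Fintype.card_congr (Equiv.sigmaFiberEquiv x)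

/-- The partition of the length of a word into the numbers of occurrences of its letters. -/
def wordPartition (x : α → β) : (Fintype.card α).Partition :=
  Nat.Partition.ofSums _ (Finset.univ.val.map (letterCount x)) (sum_letterCount x)

lemma cls_eq_of_wordPartition {x y : α → β} (h : wordPartition x = wordPartition y) :
    cls x = cls y := by
  have hpos : (Finset.univ.val.map (letterCount x)).filter (· ≠ 0) =
      (Finset.univ.val.map (letterCount y)).filter (· ≠ 0) :=
    congrArg Nat.Partition.parts h
  have split (z : α → β) := Multiset.filter_add_not (· ≠ 0) (Finset.univ.val.map (letterCount z))
  -- The zeros are dropped from the partition, but their number is determined by the alphabet.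
  have hzero (z : α → β) := Multiset.eq_replicate_card.2 fun (k : ℕ)
    (hk : k ∈ (Finset.univ.val.map (letterCount z)).filter (¬ · ≠ 0)) =>
      not_not.1 (Multiset.mem_filter.1 hk).2
  have hcard : Multiset.card ((Finset.univ.val.map (letterCount x)).filter (¬ · ≠ 0)) =
      Multiset.card ((Finset.univ.val.map (letterCount y)).filter (¬ · ≠ 0)) := by
    have hx := congrArg Multiset.card (split x)
    have hy := congrArg Multiset.card (split y)
    rw [Multiset.card_add, Multiset.card_map] at hx hy
    rw [hpos] at hx
    omega
  refine cls_eq_cls_iff_exists_letterCount.2 (exists_perm_comp_eq_of_map_univ_eq ?_)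
  rw [← split x, ← split y, hpos, hzero x, hzero y, hcard]

lemma sum_letterCount_sq_ite_mem [DecidableEq α] (s : Finset α) {a b : β} (hab : a ≠ b) :
    ∑ c, letterCount (fun i => if i ∈ s then a else b) c ^ 2 = s.card ^ 2 + sᶜ.card ^ 2 := by
  have hcount (c : β) : letterCount (fun i => if i ∈ s then a else b) c =
      (if a = c then s.card else 0) + if b = c then sᶜ.card else 0 := by
    rw [letterCount, Fintype.card_subtype]
    by_cases ha : a = c <;> by_cases hb : b = c
    · exact absurd (ha.trans hb.symm) hab
    all_goals simp [ite_eq_iff, ha, hb, Finset.compl_eq_univ_sdiff, Finset.filter_not]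
  rw [Fintype.sum_eq_add a b hab fun c hc => by simp [hcount, hc.1.symm, hc.2.symm]]
  simp [hcount, hab, hab.symm]

lemma eq_of_add_eq_of_sq_add_sq_eq {k j l i : ℕ} (hkj : k ≤ j) (hli : l ≤ i)
    (hadd : k + j = l + i) (hsq : k ^ 2 + j ^ 2 = l ^ 2 + i ^ 2) : k = l := by
  rcases lt_trichotomy k l with h | h | h
  · nlinarith
  · exact h
  · nlinarith

end LetterCount

variable [Fintype α] [Fintype β]

lemma card_wordClass_le_two_pow : Fintype.card (WordClass α β) ≤ 2 ^ Fintype.card α := by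
  classical
  have hinj : Function.Injective fun c : WordClass α β => wordPartition (cls_surjective c).choose :=
    fun c c' h => by
      simpa only [(cls_surjective _).choose_spec] using cls_eq_of_wordPartition h
  calc Fintype.card (WordClass α β)
      ≤ Fintype.card (Fintype.card α).Partition := Fintype.card_le_of_injective _ hinj
    _ ≤ Fintype.card (Composition (Fintype.card α)) :=
        Fintype.card_le_of_surjective _ Nat.Partition.ofComposition_surj
    _ ≤ 2 ^ Fintype.card α := by
        rw [composition_card]
        exact Nat.pow_le_pow_right two_pos (Nat.sub_le _ _)

lemma half_card_lt_card_wordClass [Nontrivial β] :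
    Fintype.card α / 2 < Fintype.card (WordClass α β) := by
  classical
  obtain ⟨a, b, hab⟩ := exists_pair_ne β
  have hs (k : Fin (Fintype.card α / 2 + 1)) : ∃ s : Finset α, s.card = k :=
    Finset.exists_subset_card_eq (s := .univ) (by simp; omega) |>.imp fun _ h => h.2
  choose s hs using hs
  have hinj : Function.Injective fun k => cls fun i => if i ∈ s k then a else b := by
    intro k l hkl
    obtain ⟨π, hπ⟩ := cls_eq_cls_iff_exists_letterCount.1 hkl
    have hsq : (s k).card ^ 2 + (s k)ᶜ.card ^ 2 = (s l).card ^ 2 + (s l)ᶜ.card ^ 2 := by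
      rw [← sum_letterCount_sq_ite_mem _ hab, ← sum_letterCount_sq_ite_mem _ hab, ← hπ]
      exact Equiv.sum_comp π fun c => letterCount (fun i => if i ∈ s l then a else b) c ^ 2
    rw [Finset.card_compl, Finset.card_compl, hs, hs] at hsq
    refine Fin.ext (eq_of_add_eq_of_sq_add_sq_eq ?_ ?_ ?_ hsq) <;> omega
  simpa only [Fintype.card_fin, Nat.succ_le_iff] using Fintype.card_le_of_injective _ hinj

end Words

/-! ### Integer weights on word classes -/

section Weights

variable {α β : Type*} [Fintype α] [DecidableEq α] [Fintype β]

/-- A weight on word classes is balanced up to order `γ` if it is orthogonal to every function of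
at most `γ` letters, such as the diagonal of a sum of operators acting on at most `γ` qudits. -/
def IsBalanced (γ : ℕ) (m : WordClass α β → ℤ) : Prop :=
  ∀ S : Finset α, S.card ≤ γ → ∀ h : (α → β) → ℂ, DependsOn h S →
    ∑ x, (m (cls x) : ℂ) * h x = 0

lemma IsBalanced.sum_eq_zero {γ : ℕ} {m : WordClass α β → ℤ} (hm : IsBalanced γ m) :
    ∑ x : α → β, m (cls x) = 0 := by
  have h := hm ∅ (Nat.zero_le γ) (fun _ => 1) (by simpa using dependsOn_const (1 : ℂ))
  simp only [mul_one] at h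
  exact_mod_cast h

section Marginal

variable [DecidableEq β]

/-- The total weight of the words that restrict to `w` along `ι`, as a linear function of the
weight. -/
def marginal {κ : Type*} [Fintype κ] (ι : κ ↪ α) (w : κ → β) :
    (WordClass α β → ℤ) →ₗ[ℤ] ℤ :=
  ∑ x : α → β with x ∘ ι = w, LinearMap.proj (cls x)

lemma marginal_apply {κ : Type*} [Fintype κ] (ι : κ ↪ α) (w : κ → β) (m : WordClass α β → ℤ) :
    marginal ι w m = ∑ x : α → β with x ∘ ι = w, m (cls x) := by
  simp only [marginal, LinearMap.sum_apply, LinearMap.proj_apply]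

lemma marginal_congr {γ : ℕ} (ι ι' : Fin γ ↪ α) {w w' : Fin γ → β} (hw : cls w = cls w') :
    marginal ι w = marginal ι' w' := by
  obtain ⟨π, τ, rfl⟩ := cls_eq_cls.1 hw
  obtain ⟨σ, hσ⟩ := Equiv.Perm.exists_extending_pair ι' (ι ∘ τ) ι'.injective
    (ι.injective.comp τ.injective)
  refine LinearMap.ext fun m => ?_
  rw [marginal_apply, marginal_apply]
  refine Finset.sum_equiv (σ.symm.arrowCongr π) (fun x => ?_) fun x _ =>
    congrArg m (cls_comp x π σ).symm
  have hrestrict : σ.symm.arrowCongr π x ∘ ι' = π ∘ (x ∘ ι) ∘ τ :=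
    funext fun i => congrArg (fun a => π (x a)) (hσ i)
  rw [Finset.mem_filter_univ, Finset.mem_filter_univ, hrestrict,
    π.injective.comp_left.eq_iff, τ.surjective.injective_comp_right.eq_iff]

lemma isBalanced_of_marginal_eq_zero {γ : ℕ} (hγ : γ ≤ Fintype.card α) {m : WordClass α β → ℤ}
    (hm : ∀ (ι : Fin γ ↪ α) (w : Fin γ → β), marginal ι w m = 0) : IsBalanced γ m := by
  intro S hS h hh
  obtain ⟨T, hST, hT⟩ := Finset.exists_superset_card_eq hS hγ
  let ι : Fin γ ↪ α := (T.equivFinOfCardEq hT).symm.toEmbedding.trans (.subtype _)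
  have hfactor : h.FactorsThrough (· ∘ ι) := fun x y hxy => hh fun i hi => by
    simpa [ι] using congrFun hxy (T.equivFinOfCardEq hT ⟨i, hST hi⟩)
  have hext (x : α → β) : Function.extend (· ∘ ι) h 0 (x ∘ ι) = h x := hfactor.extend_apply 0 x
  calc ∑ x, (m (cls x) : ℂ) * h x
      = ∑ w, ∑ x : α → β with x ∘ ι = w, (m (cls x) : ℂ) * h x :=
        (Finset.sum_fiberwise _ (· ∘ ι) _).symm
    _ = ∑ w, (marginal ι w m : ℂ) * Function.extend (· ∘ ι) h 0 w := by
        refine Finset.sum_congr rfl fun w _ => ?_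
        rw [marginal_apply, Int.cast_sum, Finset.sum_mul]
        refine Finset.sum_congr rfl fun x hx => ?_
        rw [← (Finset.mem_filter.1 hx).2, hext]
    _ = 0 := by simp only [hm, Int.cast_zero, zero_mul, Finset.sum_const_zero]

end Marginal

lemma exists_isBalanced_ne_zero {γ : ℕ} (h : 2 ^ γ < Fintype.card (WordClass α β)) :
    ∃ m : WordClass α β → ℤ, m ≠ 0 ∧ IsBalanced γ m := by
  classical
  have hγ : γ ≤ Fintype.card α :=
    ((Nat.pow_lt_pow_iff_right one_lt_two).1 (h.trans_le card_wordClass_le_two_pow)).le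
  obtain ⟨ι⟩ : Nonempty (Fin γ ↪ α) := Function.Embedding.nonempty_of_card_le (by simpa using hγ)
  let marginals : (WordClass α β → ℤ) →ₗ[ℤ] (WordClass (Fin γ) β → ℤ) :=
    LinearMap.pi fun c => marginal ι (cls_surjective c).choose
  have hker : LinearMap.ker marginals ≠ ⊥ := fun hbot => by
    refine (card_le_of_injective ℤ marginals (LinearMap.ker_eq_bot.1 hbot)).not_gt ?_
    exact (by simpa using card_wordClass_le_two_pow (α := Fin γ) (β := β) : _ ≤ 2 ^ γ).trans_lt h
  obtain ⟨m, hm, hm0⟩ := Submodule.exists_mem_ne_zero_of_ne_bot hker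
  refine ⟨m, hm0, isBalanced_of_marginal_eq_zero hγ fun ι' w => ?_⟩
  rw [marginal_congr ι' ι (cls_surjective (cls w)).choose_spec.symm]
  exact congrFun (LinearMap.mem_ker.1 hm) (cls w)

end Weights

/-! ### Weighted numbers of fixed words -/

section FixedWords

variable {α β : Type*}

lemma exists_perm_comp_eq_iff_factorsThrough [Finite α] (x : α → β) :
    ∃ σ : Equiv.Perm α, ∀ y : α → β, y ∘ σ = y ↔ y.FactorsThrough x := by
  have hcycle (b : β) : ∃ τ : Equiv.Perm {a // x a = b}, ∀ a a', τ.SameCycle a a' := by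
    obtain ⟨τ, hτ, -⟩ := (Set.countable_univ (α := {a // x a = b})).exists_cycleOn
    exact ⟨τ, fun a a' => hτ.2 (Set.mem_univ a) (Set.mem_univ a')⟩
  choose τ hτ using hcycle
  have hσ (b : β) (e : {a // x a = b}) : Equiv.ofFiberEquiv τ e.1 = τ b e := by
    obtain ⟨a, rfl⟩ := e
    rfl
  refine ⟨Equiv.ofFiberEquiv τ, fun y => ⟨fun hy a a' haa' => ?_, fun hy => funext fun a =>
    hy (Equiv.ofFiberEquiv_map τ a)⟩⟩
  have hinv : Function.Semiconj (fun e : {a // x a = x a'} => y e) (τ (x a')) id := fun e =>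
    (congrArg y (hσ _ e)).symm.trans (congrFun hy e)
  obtain ⟨k, hk⟩ := (hτ (x a') ⟨a, haa'⟩ ⟨a', rfl⟩).exists_nat_pow_eq
  have hpow := hinv.iterate_right k ⟨a, haa'⟩
  rwa [Equiv.Perm.iterate_eq_pow, hk, Function.iterate_id, id, eq_comm] at hpow

lemma cls_eq_of_factorsThrough [Finite β] {x y : α → β} (hy : y.FactorsThrough x)
    (hle : (Set.range x).ncard ≤ (Set.range y).ncard) : cls y = cls x := by
  set g := Function.extend x y id
  have hg (a : α) : g (x a) = y a := hy.extend_apply id a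
  have himage : g '' Set.range x = Set.range y := by
    rw [← Set.range_comp, Function.comp_def]
    simp only [hg]
  have hinj : Set.InjOn g (Set.range x) :=
    Set.injOn_of_ncard_image_eq (le_antisymm (Set.ncard_image_le) (himage ▸ hle))
  obtain ⟨π, hπ⟩ := Equiv.Perm.exists_extending_pair ((↑) : Set.range x → β)
    ((Set.range x).domRestrict g) Subtype.val_injective hinj.injective
  exact (cls_eq_cls.2 ⟨π, 1, funext fun a => ((hπ ⟨x a, a, rfl⟩).trans (hg a)).symm⟩).symm

variable [Fintype α] [DecidableEq α] [Fintype β] [DecidableEq β]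

/-- The number of words fixed by `σ`, each counted with the weight of its class. -/
def fixedWeight (m : WordClass α β → ℤ) (σ : Equiv.Perm α) : ℤ :=
  ∑ x : α → β with x ∘ σ = x, m (cls x)

lemma fixedWeight_conj (m : WordClass α β → ℤ) (σ g : Equiv.Perm α) :
    fixedWeight m (g * σ * g⁻¹) = fixedWeight m σ := by
  refine Finset.sum_equiv (g.symm.arrowCongr 1) (fun x => ?_) fun x _ =>
    congrArg m (cls_comp x 1 g).symm
  simp only [Finset.mem_filter_univ, funext_iff]
  exact (g.forall_congr fun a => by simp).symm

lemma exists_fixedWeight_ne_zero {m : WordClass α β → ℤ} (hm : m ≠ 0) :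
    ∃ σ : Equiv.Perm α, fixedWeight m σ ≠ 0 := by
  obtain ⟨c, hc⟩ := Function.ne_iff.1 hm
  obtain ⟨x₀, rfl⟩ := cls_surjective c
  -- A permutation whose cycles are the fibres of a word `x` with the fewest letters fixes exactly
  -- the words factoring through `x`; those of nonzero weight all belong to the class of `x`.
  obtain ⟨x, hx, hmin⟩ := Finset.exists_min_image {x : α → β | m (cls x) ≠ 0}
    (fun x => (Set.range x).ncard) ⟨x₀, by simpa using hc⟩
  obtain ⟨σ, hσ⟩ := exists_perm_comp_eq_iff_factorsThrough x
  simp only [Finset.mem_filter_univ] at hx hmin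
  have hclass (y : α → β) (hy : y ∘ σ = y) (hmy : m (cls y) ≠ 0) : m (cls y) = m (cls x) :=
    congrArg m (cls_eq_of_factorsThrough ((hσ y).1 hy) (hmin y hmy))
  refine ⟨σ, ?_⟩
  have hsum : fixedWeight m σ =
      ∑ y : α → β with y ∘ σ = y ∧ m (cls y) ≠ 0, m (cls x) := by
    rw [fixedWeight, ← Finset.filter_filter, ← Finset.sum_filter_ne_zero]
    exact Finset.sum_congr rfl fun y hy => by
      rw [Finset.mem_filter, Finset.mem_filter_univ] at hy
      exact hclass y hy.1 hy.2
  rw [hsum, Finset.sum_const, smul_ne_zero_iff]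
  refine ⟨Finset.card_ne_zero.2 ⟨x, ?_⟩, hx⟩
  exact Finset.mem_filter_univ _ |>.2 ⟨(hσ x).2 fun _ _ => id, hx⟩

end FixedWords

/-! ### Symmetric operators preserve word classes -/

lemma tensorPow_diagonal {ι : Type} [DecidableEq ι] (k : ℕ) (v : ι → ℂ) :
    tensorPow k (Matrix.diagonal v) = Matrix.diagonal fun x => ∏ i, v (x i) := by
  ext x y
  rw [tensorPow, Matrix.of_apply, Matrix.diagonal_apply]
  split_ifs with hxy
  · simp [hxy]
  · obtain ⟨i, hi⟩ := Function.ne_iff.1 hxy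
    exact Finset.prod_eq_zero (Finset.mem_univ i) (Matrix.diagonal_apply_ne _ hi)

lemma exists_norm_eq_one_prod_mul_eq_one {ι : Type*} [Fintype ι] {v : ι → ℂ}
    (hv : ∀ j, ‖v j‖ = 1) : ∃ ζ : ℂ, ‖ζ‖ = 1 ∧ ∏ j, ζ * v j = 1 := by
  cases isEmpty_or_nonempty ι
  · exact ⟨1, norm_one, by simp⟩
  · have hprod : ‖∏ j, v j‖ = 1 := by simp [norm_prod, hv]
    have hcard : Fintype.card ι ≠ 0 := Fintype.card_ne_zero
    obtain ⟨ζ, hζ⟩ := IsAlgClosed.exists_pow_nat_eq (∏ j, v j)⁻¹ (Nat.pos_of_ne_zero hcard)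
    refine ⟨ζ, ?_, ?_⟩
    · rw [← pow_eq_one_iff_of_nonneg (norm_nonneg ζ) hcard, ← norm_pow, hζ, norm_inv, hprod,
        inv_one]
    · rw [Finset.prod_mul_distrib, Finset.prod_const, Finset.card_univ, hζ]
      exact inv_mul_cancel₀ (norm_ne_zero_iff.1 (hprod ▸ one_ne_zero))

lemma diagonal_mem_unitaryGroup {ι : Type*} [Fintype ι] [DecidableEq ι] {v : ι → ℂ}
    (hv : ∀ j, ‖v j‖ = 1) : Matrix.diagonal v ∈ Matrix.unitaryGroup ι ℂ := by
  have hmul : ∀ j, v j * star (v j) = 1 := fun j => by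
    rw [RCLike.star_def, Complex.mul_conj, Complex.normSq_eq_norm_sq, hv]
    simp
  rw [Matrix.mem_unitaryGroup_iff, Matrix.star_eq_conjTranspose, Matrix.diagonal_conjTranspose,
    Matrix.diagonal_mul_diagonal]
  simp only [Pi.star_apply, hmul, Matrix.diagonal_one]

section Symmetric

variable {n d : ℕ} {A : Matrix (Idx n d) (Idx n d) ℂ}

lemma IsSymmetric.commute_diagonal (hA : IsSymmetric A) {v : Fin d → ℂ} (hv : ∀ j, ‖v j‖ = 1) :
    Commute A (Matrix.diagonal fun x => ∏ i, v (x i)) := by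
  obtain ⟨ζ, hζ, hζv⟩ := exists_norm_eq_one_prod_mul_eq_one hv
  have hmem : Matrix.diagonal (fun j => ζ * v j) ∈ Matrix.specialUnitaryGroup (Fin d) ℂ :=
    Matrix.mem_specialUnitaryGroup_iff.2
      ⟨diagonal_mem_unitaryGroup fun j => by rw [norm_mul, hζ, hv, one_mul],
        by rw [Matrix.det_diagonal, hζv]⟩
  have hsmul : tensorPow n (Matrix.diagonal fun j => ζ * v j) =
      ζ ^ n • Matrix.diagonal fun x => ∏ i, v (x i) := by
    simp only [tensorPow_diagonal, Finset.prod_mul_distrib, Finset.prod_const, Finset.card_univ,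
      Fintype.card_fin, ← Matrix.diagonal_smul]
    rfl
  have hζ0 : ζ ^ n ≠ 0 := pow_ne_zero _ (norm_ne_zero_iff.1 (hζ ▸ one_ne_zero))
  exact (Commute.smul_right_iff₀ hζ0).1 (hsmul ▸ hA _ hmem)

lemma IsSymmetric.apply_eq_zero (hA : IsSymmetric A) {x y : Idx n d} (hxy : cls x ≠ cls y) :
    A x y = 0 := by
  by_contra hAxy
  refine hxy (cls_eq_cls_iff_exists_letterCount.2 ⟨1, funext fun j => ?_⟩)
  have hw := Complex.isPrimitiveRoot_exp (n + 1) n.succ_ne_zero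
  set w := Complex.exp (2 * Real.pi * Complex.I / ((n + 1 : ℕ) : ℂ))
  -- Multiplying the letter `j` by `w` turns commutation into `w ^ #j(x) = w ^ #j(y)`.
  have hcomm := hA.commute_diagonal (v := Pi.mulSingle j w) fun k => by
    rcases eq_or_ne k j with rfl | hk
    · rw [Pi.mulSingle_eq_same]
      exact hw.norm'_eq_one n.succ_ne_zero
    · rw [Pi.mulSingle_eq_of_ne hk, norm_one]
  have hprod : ∀ z : Idx n d,
      ∏ i, (Pi.mulSingle j w : Fin d → ℂ) (z i) = w ^ letterCount z j := fun z => by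
    simp only [Pi.mulSingle_apply, Finset.prod_ite, Finset.prod_const, one_pow, mul_one,
      letterCount, Fintype.card_subtype]
  have hlt : ∀ z : Idx n d, letterCount z j < n + 1 := fun z =>
    Nat.lt_succ_of_le ((Fintype.card_subtype_le _).trans_eq (Fintype.card_fin n))
  have hxy' := congrFun₂ hcomm.eq x y
  rw [Matrix.mul_diagonal, Matrix.diagonal_mul, hprod, hprod, mul_comm] at hxy'
  exact hw.pow_inj (hlt y) (hlt x) (mul_right_cancel₀ hAxy hxy')

end Symmetric

section BlockDiagonal

variable {ι κ : Type*} [Fintype ι] [DecidableEq κ] {b : ι → κ}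

lemma toSquareBlock_mul {R : Type*} [CommRing R] {A : Matrix ι ι R}
    (hA : ∀ x y, b x ≠ b y → A x y = 0) (B : Matrix ι ι R) (c : κ) :
    (A * B).toSquareBlock b c = A.toSquareBlock b c * B.toSquareBlock b c := by
  have hzero : A.toBlock (b · = c) (fun x => ¬ b x = c) = 0 := by
    ext x y
    exact hA _ _ fun hxy => y.2 (hxy ▸ x.2)
  change (A * B).toBlock _ _ = A.toBlock _ _ * B.toBlock _ _
  rw [Matrix.toBlock_mul_eq_add (q := (b · = c)), hzero, Matrix.zero_mul, add_zero]

variable [DecidableEq ι]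

lemma toSquareBlock_pow {R : Type*} [CommRing R] {A : Matrix ι ι R}
    (hA : ∀ x y, b x ≠ b y → A x y = 0) (c : κ) (r : ℕ) :
    (A ^ r).toSquareBlock b c = A.toSquareBlock b c ^ r := by
  induction r with
  | zero => exact Matrix.toBlock_one_self _
  | succ r ih => rw [pow_succ', pow_succ', toSquareBlock_mul hA, ih]

open scoped Matrix.Norms.Operator Nat in
lemma toSquareBlock_exp {A : Matrix ι ι ℂ} (hA : ∀ x y, b x ≠ b y → A x y = 0) (c : κ) :
    (NormedSpace.exp A).toSquareBlock b c = NormedSpace.exp (A.toSquareBlock b c) := by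
  let block : Matrix ι ι ℂ →+ Matrix {x // b x = c} {x // b x = c} ℂ :=
    { toFun := fun B => B.toSquareBlock b c
      map_zero' := rfl
      map_add' := fun _ _ => rfl }
  have hcont : Continuous block :=
    continuous_matrix fun x y => continuous_id.matrix_elem x.1 y.1
  have hsum := (NormedSpace.exp_series_hasSum_exp' (𝕂 := ℂ) A).map block hcont
  refine hsum.unique ((NormedSpace.exp_series_hasSum_exp' (𝕂 := ℂ) _).congr_fun fun r => ?_)
  change (r ! : ℂ)⁻¹ • (A ^ r).toSquareBlock b c = _
  rw [toSquareBlock_pow hA]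

end BlockDiagonal

/-! ### The characters attached to integer weights on word classes -/

lemma det_exp_of_isHermitian {ι : Type*} [Fintype ι] [DecidableEq ι] {H : Matrix ι ι ℂ}
    (hH : H.IsHermitian) (z : ℂ) : (NormedSpace.exp (z • H)).det = Complex.exp (z * H.trace) := by
  have hspec := hH.spectral_theorem
  rw [Unitary.conjStarAlgAut_apply] at hspec
  set W : Matrix ι ι ℂ := (hH.eigenvectorUnitary : Matrix ι ι ℂ)
  have hWW : W * star W = 1 := Unitary.coe_mul_star_self hH.eigenvectorUnitary
  have hW : IsUnit W := IsUnit.of_mul_eq_one _ hWW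
  rw [← Matrix.inv_eq_right_inv hWW] at hspec
  have hconj : z • H =
      W * Matrix.diagonal (z • (RCLike.ofReal ∘ hH.eigenvalues : ι → ℂ)) * W⁻¹ := by
    conv_lhs => rw [hspec]
    rw [Matrix.diagonal_smul, Matrix.mul_smul, Matrix.smul_mul]
  rw [hconj, Matrix.exp_conj _ _ hW, Matrix.det_conj hW, Matrix.exp_diagonal, Matrix.det_diagonal,
    hH.trace_eq_sum_eigenvalues, Finset.mul_sum, Complex.exp_sum]
  refine Finset.prod_congr rfl fun i _ => ?_
  rw [Pi.coe_exp, ← Complex.exp_eq_exp_ℂ]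
  rfl

section Characters

variable {n d : ℕ}

lemma SymU.mat_mul (U W : SymU n d) : (U * W).mat = U.mat * W.mat := rfl

lemma SymU.mat_apply_eq_zero (U : SymU n d) (x y : Idx n d) (hxy : cls x ≠ cls y) :
    U.mat x y = 0 :=
  IsSymmetric.apply_eq_zero U.2 hxy

/-- The determinant of the block of a symmetric unitary on a word class, as a character. -/
def classDet (c : WordClass (Fin n) (Fin d)) : SymU n d →* ℂ where
  toFun U := (U.mat.toSquareBlock cls c).det
  map_one' := by
    change ((1 : Matrix (Idx n d) (Idx n d) ℂ).toSquareBlock cls c).det = 1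
    rw [show (1 : Matrix (Idx n d) (Idx n d) ℂ).toSquareBlock cls c = 1 from
      Matrix.toBlock_one_self _, Matrix.det_one]
  map_mul' U W := by
    rw [SymU.mat_mul, toSquareBlock_mul U.mat_apply_eq_zero, Matrix.det_mul]

lemma classDet_apply (c : WordClass (Fin n) (Fin d)) (U : SymU n d) :
    classDet c U = (U.mat.toSquareBlock cls c).det := rfl

lemma continuous_classDet (c : WordClass (Fin n) (Fin d)) : Continuous (classDet c) :=
  Continuous.matrix_det <| continuous_matrix fun x y =>
    SymU.continuous_mat.matrix_elem x.1 y.1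

lemma classDet_ne_zero (c : WordClass (Fin n) (Fin d)) (U : SymU n d) : classDet c U ≠ 0 :=
  ((Group.isUnit U).map (classDet c)).ne_zero

lemma classDet_inv (c : WordClass (Fin n) (Fin d)) (U : SymU n d) :
    classDet c U⁻¹ = star (classDet c U) := by
  rw [classDet_apply, classDet_apply, ← Matrix.det_conjTranspose]
  rfl

lemma classDet_of_mat_eq_exp (c : WordClass (Fin n) (Fin d)) {U : SymU n d}
    {H : Matrix (Idx n d) (Idx n d) ℂ} (hH : H.IsHermitian) (hsym : IsSymmetric H) {z : ℂ}
    (hU : U.mat = NormedSpace.exp (z • H)) :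
    classDet c U = Complex.exp (z * ∑ x : {x // cls x = c}, H x x) := by
  have hHc : (H.toSquareBlock cls c).IsHermitian := hH.submatrix _
  rw [classDet_apply, hU,
    toSquareBlock_exp fun x y hxy => by rw [Matrix.smul_apply, hsym.apply_eq_zero hxy, smul_zero]]
  exact det_exp_of_isHermitian hHc z

/-- The character `U ↦ ∏ det(U_c) ^ m c` attached to integer weights `m` on the word classes,
where `U_c` is the block of `U` on the class `c`. -/
def weightHom (m : WordClass (Fin n) (Fin d) → ℤ) : SymU n d →* ℂ where
  toFun U := ∏ c, classDet c U ^ m c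
  map_one' := by simp only [map_one, one_zpow, Finset.prod_const_one]
  map_mul' U W := by simp only [map_mul, mul_zpow, Finset.prod_mul_distrib]

lemma continuous_weightHom (m : WordClass (Fin n) (Fin d) → ℤ) : Continuous (weightHom m) :=
  continuous_finsetProd _ fun c _ =>
    (continuous_classDet c).zpow₀ (m c) fun U => Or.inl (classDet_ne_zero c U)

lemma weightHom_of_mat_eq_exp (m : WordClass (Fin n) (Fin d) → ℤ) {U : SymU n d}
    {H : Matrix (Idx n d) (Idx n d) ℂ} (hH : H.IsHermitian) (hsym : IsSymmetric H) {z : ℂ}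
    (hU : U.mat = NormedSpace.exp (z • H)) :
    weightHom m U = Complex.exp (z * ∑ x, (m (cls x) : ℂ) * H x x) := by
  calc weightHom m U = ∏ c, Complex.exp (z * ∑ x : {x // cls x = c}, H x x) ^ m c :=
        Finset.prod_congr rfl fun c _ => by rw [classDet_of_mat_eq_exp c hH hsym hU]
    _ = Complex.exp (z * ∑ c, ∑ x : {x // cls x = c}, (m c : ℂ) * H x x) := by
        rw [Finset.mul_sum, Complex.exp_sum]
        refine Finset.prod_congr rfl fun c _ => ?_
        rw [← Complex.exp_int_mul, ← Finset.mul_sum, mul_left_comm]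
    _ = Complex.exp (z * ∑ x, (m (cls x) : ℂ) * H x x) := by
        rw [← Fintype.sum_fiberwise cls]
        congr! 6 with c _ x
        exact congrArg m x.2.symm

end Characters

/-! ### Balanced characters are trivial on local gates -/

section PermMatrix

variable {ι R : Type*} [Fintype ι] [DecidableEq ι] [CommRing R]

lemma commute_permMatrix_iff {e : Equiv.Perm ι} {A : Matrix ι ι R} :
    Commute A (e.permMatrix R) ↔ ∀ i j, A (e i) (e j) = A i j := by
  have hentry : Commute A (e.permMatrix R) ↔ ∀ i j, A i (e.symm j) = A (e i) j := by
    rw [Commute, SemiconjBy, PEquiv.mul_toMatrix_toPEquiv, PEquiv.toMatrix_toPEquiv_mul,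
      ← Matrix.ext_iff]
    rfl
  rw [hentry]
  refine forall_congr' fun i => ⟨fun h j => ?_, fun h j => ?_⟩
  · rw [← h, e.symm_apply_apply]
  · rw [← h, e.apply_symm_apply]

end PermMatrix

open scoped Matrix.Norms.L2Operator in
lemma exists_isHermitian_exp_eq {ι : Type*} [Fintype ι] [DecidableEq ι] {U : Matrix ι ι ℂ}
    (hU : U ∈ Matrix.unitaryGroup ι ℂ) :
    ∃ H : Matrix ι ι ℂ, H.IsHermitian ∧ U = NormedSpace.exp ((-Complex.I) • H) ∧
      ∀ B, Commute U B → Commute H B := by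
  have hfin : (spectrum ℂ U).Finite := Matrix.finite_spectrum U
  have hnormal : IsStarNormal U := ⟨(Unitary.star_mul_self_of_mem hU).trans
    (Unitary.mul_star_self_of_mem hU).symm⟩
  let f : ℂ → ℂ := fun z => ((-z.arg : ℝ) : ℂ)
  have hH : IsSelfAdjoint (cfc f U) := by
    rw [IsSelfAdjoint, ← cfc_star]
    exact cfc_congr fun z _ => Complex.conj_ofReal _
  refine ⟨cfc f U, hH, ?_, fun B hB => hB.cfc ?_ f⟩
  · have hHnormal : IsStarNormal (cfc f U) := hH.isStarNormal
    rw [← CFC.exp_eq_normedSpace_exp (𝕜 := ℂ), ← cfc_comp_smul (-Complex.I) _ (cfc f U),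
      ← cfc_comp' _ f U (hg := (hfin.image f).continuousOn _) (hf := hfin.continuousOn f)]
    conv_lhs => rw [← cfc_id' ℂ U]
    refine cfc_congr fun z hz => ?_
    have hpolar := Complex.norm_mul_exp_arg_mul_I z
    rw [spectrum.norm_eq_one_of_unitary hU hz, Complex.ofReal_one, one_mul] at hpolar
    simp only [← Complex.exp_eq_exp_ℂ, f, smul_eq_mul, Complex.ofReal_neg, neg_mul_neg,
      mul_comm Complex.I, hpolar]
  · have hB' : Commute (Unitary.toUnits ⟨U, hU⟩ : Matrix ι ι ℂ) B := hB
    exact hB'.units_inv_left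

section Local

variable {n d γ : ℕ} {S : Finset (Fin n)}

lemma ActsOn.commute_permMatrix {A : Matrix (Idx n d) (Idx n d) ℂ} (hA : ActsOn S A)
    {e : Fin n → Equiv.Perm (Fin d)} (he : ∀ i ∈ S, e i = 1) :
    Commute A (Equiv.Perm.permMatrix ℂ (Equiv.piCongrRight e)) := by
  obtain ⟨B, hB⟩ := hA
  have hfix : ∀ x : Idx n d, (fun i : S => Equiv.piCongrRight e x i) = fun i : S => x i :=
    fun x => funext fun i => by rw [Equiv.piCongrRight_apply, Pi.map_apply, he i i.2]; rfl
  refine commute_permMatrix_iff.2 fun x y => ?_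
  simp only [hB, hfix]
  simp only [Equiv.piCongrRight_apply, Pi.map_apply, EmbeddingLike.apply_eq_iff_eq]

lemma dependsOn_diag_of_commute_permMatrix {H : Matrix (Idx n d) (Idx n d) ℂ}
    (hH : ∀ e : Fin n → Equiv.Perm (Fin d), (∀ i ∈ S, e i = 1) →
      Commute H (Equiv.Perm.permMatrix ℂ (Equiv.piCongrRight e))) :
    DependsOn (fun x => H x x) (S : Set (Fin n)) := by
  intro x y hxy
  let e : Fin n → Equiv.Perm (Fin d) := fun i => Equiv.swap (x i) (y i)
  have he : ∀ i ∈ S, e i = 1 := fun i hi => by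
    simp only [e, ← show x i = y i from hxy i hi, Equiv.swap_self]
    rfl
  have hex : Equiv.piCongrRight e x = y := funext fun i => Equiv.swap_apply_left (x i) (y i)
  rw [← hex]
  exact (commute_permMatrix_iff.1 (hH e he) x x).symm

variable {m : WordClass (Fin n) (Fin d) → ℤ}

lemma IsBalanced.sum_diag_eq_zero (hm : IsBalanced γ m) {H : Matrix (Idx n d) (Idx n d) ℂ}
    (hH : H ∈ Submodule.span ℂ {A | IsLocal γ A}) : ∑ x, (m (cls x) : ℂ) * H x x = 0 := by
  induction hH using Submodule.span_induction with
  | mem A hA =>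
    obtain ⟨S, hS, hA⟩ := hA
    exact hm S hS _ (dependsOn_diag_of_commute_permMatrix fun _ => hA.commute_permMatrix)
  | zero => simp only [Matrix.zero_apply, mul_zero, Finset.sum_const_zero]
  | add A B _ _ hA hB =>
    simp only [Matrix.add_apply, mul_add, Finset.sum_add_distrib, hA, hB, add_zero]
  | smul z A _ hA =>
    simp only [Matrix.smul_apply, smul_eq_mul, mul_left_comm _ z, ← Finset.mul_sum, hA, mul_zero]

lemma IsBalanced.weightHom_eq_one_of_isLocalHamiltonian (hm : IsBalanced γ m)
    {H : Matrix (Idx n d) (Idx n d) ℂ} (hH : IsLocalHamiltonian γ H) {U : SymU n d}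
    (hU : U.mat = NormedSpace.exp ((-Complex.I) • H)) : weightHom m U = 1 := by
  obtain ⟨hherm, hsym, hlocal⟩ := hH
  rw [weightHom_of_mat_eq_exp m hherm hsym hU, hm.sum_diag_eq_zero hlocal, mul_zero,
    Complex.exp_zero]

lemma IsBalanced.weightHom_eq_one_of_isLocal (hm : IsBalanced γ m) {U : SymU n d}
    (hU : IsLocal γ U.mat) : weightHom m U = 1 := by
  obtain ⟨S, hS, hUS⟩ := hU
  obtain ⟨H, hherm, hexp, hcomm⟩ := exists_isHermitian_exp_eq U.1.2
  -- `H` need not act on `S` only, but it commutes with all relabellings of the letters at sites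
  -- off `S`.
  have hdiag : DependsOn (fun x => H x x) (S : Set (Fin n)) :=
    dependsOn_diag_of_commute_permMatrix fun _ he => hcomm _ (hUS.commute_permMatrix he)
  have hsym : IsSymmetric H := fun V hV => hcomm _ (U.2 V hV)
  rw [weightHom_of_mat_eq_exp m hherm hsym hexp, hm S hS _ hdiag, mul_zero, Complex.exp_zero]

lemma IsBalanced.localGroup_le_ker (hm : IsBalanced γ m) :
    localGroup n d γ ≤ (weightHom m).ker := by
  refine Subgroup.topologicalClosure_minimal _ ((Subgroup.closure_le _).2 ?_)
    (isClosed_eq (continuous_weightHom m) continuous_const)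
  rintro U (hU | ⟨H, hH, hU⟩)
  · exact hm.weightHom_eq_one_of_isLocal hU
  · exact hm.weightHom_eq_one_of_isLocalHamiltonian hH hU

end Local

/-! ### Weights of mixed tensor powers -/

section TensorPow

variable {ι : Type}

lemma tensorPow_one [DecidableEq ι] (k : ℕ) : tensorPow k (1 : Matrix ι ι ℂ) = 1 := by
  rw [← Matrix.diagonal_one, tensorPow_diagonal]
  simp only [Finset.prod_const_one, Matrix.diagonal_one]

lemma tensorPow_conjTranspose (k : ℕ) (A : Matrix ι ι ℂ) : tensorPow k Aᴴ = (tensorPow k A)ᴴ := by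
  ext x y
  simp only [tensorPow, Matrix.of_apply, Matrix.conjTranspose_apply, star_prod]

lemma tensorPow_zero [DecidableEq ι] (A : Matrix ι ι ℂ) : tensorPow 0 A = 1 := by
  ext x y
  rw [Subsingleton.elim y x, Matrix.one_apply_eq]
  rfl

open scoped Kronecker in
lemma tensorPow_add (k l : ℕ) (A : Matrix ι ι ℂ) :
    tensorPow (k + l) A = (tensorPow k A ⊗ₖ tensorPow l A).submatrix
      (Fin.appendEquiv k l).symm (Fin.appendEquiv k l).symm := by
  ext x y
  exact Fin.prod_univ_add fun i => A (x i) (y i)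

lemma tensorPow_mul [Fintype ι] (k : ℕ) (A B : Matrix ι ι ℂ) :
    tensorPow k (A * B) = tensorPow k A * tensorPow k B := by
  classical
  ext x y
  simp only [tensorPow, Matrix.of_apply, Matrix.mul_apply, ← Finset.prod_mul_distrib]
  rw [Finset.prod_univ_sum, Fintype.piFinset_univ]

end TensorPow

lemma sum_prod_mul_det_submatrix {ι κ R : Type*} [Fintype ι] [Fintype κ] [DecidableEq κ]
    [CommRing R] (A : Matrix κ ι R) (B : Matrix ι κ R) :
    ∑ y : κ → ι, (∏ i, A i (y i)) * (B.submatrix y id).det = (A * B).det := by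
  have hrows : A * B = fun i => ∑ j, A i j • B j := by
    ext i c
    simp only [Matrix.mul_apply, Finset.sum_apply, Pi.smul_apply, smul_eq_mul]
  calc ∑ y : κ → ι, (∏ i, A i (y i)) * (B.submatrix y id).det
      = ∑ y : κ → ι, Matrix.detRowAlternating fun i => A i (y i) • B (y i) :=
        Finset.sum_congr rfl fun y _ =>
          (Matrix.detRowAlternating.toMultilinearMap.map_smul_univ _ _).symm
    _ = Matrix.detRowAlternating fun i => ∑ j, A i j • B j :=
        (Matrix.detRowAlternating.toMultilinearMap.map_sum fun i j => A i j • B j).symm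
    _ = (A * B).det := congrArg Matrix.det hrows.symm

section TensorWeight

variable {G : Type*} {ι : Type} [Fintype ι] {ρ : G → Matrix ι ι ℂ}

/-- The function `χ` is a weight of the mixed tensor power `ρ^{⊗ k} ⊗ ρ̄^{⊗ l}`. The tensors are
written as operators `M` from the `l`-fold to the `k`-fold tensor power, on which `ρ` acts by
`M ↦ ρ^{⊗ k} M (ρ^{⊗ l})†`. -/
def HasTensorWeight (ρ : G → Matrix ι ι ℂ) (k l : ℕ) (χ : G → ℂ) : Prop :=
  ∃ M : Matrix (Fin k → ι) (Fin l → ι) ℂ, M ≠ 0 ∧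
    ∀ g, tensorPow k (ρ g) * M * (tensorPow l (ρ g))ᴴ = χ g • M

variable {k l : ℕ} {χ : G → ℂ}

lemma HasTensorWeight.star (h : HasTensorWeight ρ k l χ) : HasTensorWeight ρ l k (star χ) := by
  obtain ⟨M, hM, hχ⟩ := h
  refine ⟨Mᴴ, Matrix.conjTranspose_eq_zero.not.2 hM, fun g => ?_⟩
  simpa only [Matrix.conjTranspose_mul, Matrix.conjTranspose_conjTranspose,
    Matrix.conjTranspose_smul, Matrix.mul_assoc, Pi.star_apply] using
    congrArg Matrix.conjTranspose (hχ g)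

open scoped Kronecker in
lemma HasTensorWeight.mul {k' l' : ℕ} {χ' : G → ℂ} (h : HasTensorWeight ρ k l χ)
    (h' : HasTensorWeight ρ k' l' χ') : HasTensorWeight ρ (k + k') (l + l') (χ * χ') := by
  obtain ⟨M, hM, hχ⟩ := h
  obtain ⟨M', hM', hχ'⟩ := h'
  refine ⟨(M ⊗ₖ M').submatrix (Fin.appendEquiv k k').symm (Fin.appendEquiv l l').symm,
    fun h0 => ?_, fun g => ?_⟩
  · obtain ⟨x, y, hxy⟩ : ∃ x y, M x y ≠ 0 := by
      simpa only [ne_eq, ← Matrix.ext_iff, not_forall, Matrix.zero_apply] using hM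
    obtain ⟨x', y', hxy'⟩ : ∃ x y, M' x y ≠ 0 := by
      simpa only [ne_eq, ← Matrix.ext_iff, not_forall, Matrix.zero_apply] using hM'
    have hentry := congrFun₂ h0 (Fin.appendEquiv k k' (x, x')) (Fin.appendEquiv l l' (y, y'))
    rw [Matrix.submatrix_apply, Equiv.symm_apply_apply, Equiv.symm_apply_apply] at hentry
    exact mul_ne_zero hxy hxy' hentry
  · rw [tensorPow_add, tensorPow_add, Matrix.conjTranspose_submatrix, Matrix.submatrix_mul_equiv,
      Matrix.submatrix_mul_equiv, Matrix.conjTranspose_kronecker, ← Matrix.mul_kronecker_mul,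
      ← Matrix.mul_kronecker_mul, hχ, hχ', Matrix.smul_kronecker, Matrix.kronecker_smul, smul_smul]
    rfl

lemma hasTensorWeight_zero_zero : HasTensorWeight ρ 0 0 1 := by
  classical
  refine ⟨1, one_ne_zero, fun g => ?_⟩
  rw [tensorPow_zero, one_mul, Matrix.conjTranspose_one, one_mul, Pi.one_apply, one_smul]

lemma HasTensorWeight.prod {κ : Type*} (s : Finset κ) {a b : κ → ℕ} {ψ : κ → G → ℂ}
    (h : ∀ i ∈ s, HasTensorWeight ρ (a i) (b i) (ψ i)) :
    HasTensorWeight ρ (∑ i ∈ s, a i) (∑ i ∈ s, b i) (∏ i ∈ s, ψ i) := by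
  classical
  induction s using Finset.induction_on with
  | empty => exact hasTensorWeight_zero_zero
  | insert i s hi ih =>
    rw [Finset.sum_insert hi, Finset.sum_insert hi, Finset.prod_insert hi]
    exact (h i (s.mem_insert_self i)).mul (ih fun j hj => h j (Finset.mem_insert_of_mem hj))

lemma HasTensorWeight.pow (h : HasTensorWeight ρ k l χ) (r : ℕ) :
    HasTensorWeight ρ (r * k) (r * l) (χ ^ r) := by
  simpa only [Finset.sum_const, Finset.prod_const, Finset.card_range, smul_eq_mul] using
    HasTensorWeight.prod (Finset.range r) fun _ _ => h

lemma hasTensorWeight_det_submatrix {N : ℕ} (e : Fin N ↪ ι)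
    (he : ∀ g, ∀ x ∉ Set.range e, ∀ j, ρ g x (e j) = 0) :
    HasTensorWeight ρ N 0 fun g => ((ρ g).submatrix e e).det := by
  classical
  -- `M` is the antisymmetric tensor `e₁ ∧ ⋯ ∧ e_N`.
  let M : Matrix (Fin N → ι) (Fin 0 → ι) ℂ :=
    Matrix.of fun x _ => ((1 : Matrix ι ι ℂ).submatrix x e).det
  refine ⟨M, fun h0 => ?_, fun g => ?_⟩
  · have hentry := congrFun₂ h0 e Fin.elim0
    change ((1 : Matrix ι ι ℂ).submatrix e e).det = 0 at hentry
    rw [Matrix.submatrix_one_embedding, Matrix.det_one] at hentry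
    exact one_ne_zero hentry
  · have hblock : ∀ x : Fin N → ι, (ρ g).submatrix x e =
        (1 : Matrix ι ι ℂ).submatrix x e * (ρ g).submatrix e e := fun x => by
      ext i j
      rw [Matrix.mul_apply]
      by_cases hx : x i ∈ Set.range e
      · obtain ⟨r, hr⟩ := hx
        simp [← hr, Matrix.one_apply]
      · rw [Matrix.submatrix_apply, he g _ hx]
        refine (Finset.sum_eq_zero fun r _ => ?_).symm
        rw [Matrix.submatrix_apply, Matrix.one_apply_ne fun h => hx ⟨r, h.symm⟩, zero_mul]
    ext x z
    rw [tensorPow_zero, Matrix.conjTranspose_one, Matrix.mul_one]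
    calc (tensorPow N (ρ g) * M) x z
        = ((ρ g).submatrix x id * (1 : Matrix ι ι ℂ).submatrix id e).det := by
          rw [Matrix.mul_apply, ← sum_prod_mul_det_submatrix]
          rfl
      _ = ((ρ g).submatrix x e).det := by
          rw [← Matrix.submatrix_mul _ _ x id e Function.bijective_id, mul_one]
      _ = ((ρ g).submatrix e e).det * ((1 : Matrix ι ι ℂ).submatrix x e).det := by
          rw [hblock, Matrix.det_mul, mul_comm]

variable [DecidableEq ι]

lemma hasTensorWeight_self_self [Nonempty ι] (hρ : ∀ g, ρ g ∈ Matrix.unitaryGroup ι ℂ) (k : ℕ) :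
    HasTensorWeight ρ k k 1 := by
  refine ⟨1, one_ne_zero, fun g => ?_⟩
  rw [mul_one, ← tensorPow_conjTranspose, ← tensorPow_mul, ← Matrix.star_eq_conjTranspose,
    Matrix.mem_unitaryGroup_iff.1 (hρ g), tensorPow_one, Pi.one_apply, one_smul]

lemma hasTensorWeight_det_toSquareBlock {κ : Type*} [DecidableEq κ] {b : ι → κ}
    (hρ : ∀ g x y, b x ≠ b y → ρ g x y = 0) (c : κ) :
    HasTensorWeight ρ (Fintype.card {x // b x = c}) 0 fun g =>
      ((ρ g).toSquareBlock b c).det := by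
  let e := (Fintype.equivFin {x // b x = c}).symm
  have hweight := hasTensorWeight_det_submatrix (ρ := ρ)
    (e.toEmbedding.trans (.subtype _)) fun g x hx j => hρ g x _ fun hxj => hx
      ⟨e.symm ⟨x, hxj.trans (e j).2⟩, by simp⟩
  convert hweight using 2 with g
  exact (Matrix.det_submatrix_equiv_self e _).symm

end TensorWeight

section WeightHom

variable {n d : ℕ}

lemma classDet_zpow_eq (c : WordClass (Fin n) (Fin d)) (r : ℤ) :
    (fun U : SymU n d => classDet c U ^ r) =
      ⇑(classDet c) ^ r.toNat * star ⇑(classDet c) ^ (-r).toNat := by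
  funext U
  have hstar : star (classDet c U) = (classDet c U)⁻¹ := by
    rw [← classDet_inv, ← mul_eq_one_iff_eq_inv₀ (classDet_ne_zero c U), ← map_mul, inv_mul_cancel,
      map_one]
  simp only [Pi.mul_apply, Pi.pow_apply, Pi.star_apply, hstar, inv_pow]
  rw [← div_eq_mul_inv, ← zpow_natCast, ← zpow_natCast, ← zpow_sub₀ (classDet_ne_zero c U),
    Int.toNat_sub_toNat_neg]

lemma hasTensorWeight_classDet_zpow (c : WordClass (Fin n) (Fin d)) (r : ℤ) :
    HasTensorWeight (SymU.mat (n := n) (d := d)) (r.toNat * Fintype.card {x : Idx n d // cls x = c})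
      ((-r).toNat * Fintype.card {x : Idx n d // cls x = c}) fun U => classDet c U ^ r := by
  have hdet : HasTensorWeight SymU.mat _ 0 (classDet c) :=
    hasTensorWeight_det_toSquareBlock SymU.mat_apply_eq_zero c
  rw [classDet_zpow_eq]
  simpa only [mul_zero, add_zero, zero_add] using (hdet.pow r.toNat).mul (hdet.star.pow (-r).toNat)

lemma exists_hasTensorWeight_weightHom [Nonempty (Idx n d)] {m : WordClass (Fin n) (Fin d) → ℤ}
    (hm : ∑ x : Idx n d, m (cls x) = 0) :
    ∃ k₀, ∀ k ≥ k₀, HasTensorWeight SymU.mat k k (weightHom m) := by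
  let N : WordClass (Fin n) (Fin d) → ℕ := fun c => Fintype.card {x : Idx n d // cls x = c}
  have hdegree : ∑ c, (m c).toNat * N c = ∑ c, (-m c).toNat * N c := by
    have hsum : ∑ c, m c * N c = 0 := by
      rw [← hm, ← Fintype.sum_fiberwise cls]
      refine Finset.sum_congr rfl fun c _ => ?_
      rw [Finset.sum_congr rfl fun (x : {x : Idx n d // cls x = c}) _ => congrArg m x.2,
        Finset.sum_const, Finset.card_univ, nsmul_eq_mul, mul_comm]
    zify
    rw [← sub_eq_zero, ← Finset.sum_sub_distrib, ← hsum]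
    exact Finset.sum_congr rfl fun c _ => by rw [← sub_mul, Int.toNat_sub_toNat_neg]
  have hweight : HasTensorWeight SymU.mat (∑ c, (m c).toNat * N c) (∑ c, (m c).toNat * N c)
      (weightHom m) := by
    have hprod := HasTensorWeight.prod Finset.univ fun c _ =>
      hasTensorWeight_classDet_zpow c (m c)
    rw [← hdegree] at hprod
    convert hprod
    funext U
    exact (Finset.prod_apply U _ fun c U => classDet c U ^ m c).symm
  refine ⟨∑ c, (m c).toNat * N c, fun k hk => ?_⟩
  obtain ⟨r, rfl⟩ := Nat.exists_eq_add_of_le hk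
  simpa only [mul_one] using hweight.mul
    (hasTensorWeight_self_self (ρ := SymU.mat) (fun U : SymU n d => U.1.2) r)

end WeightHom

/-! ### Characters obstruct designs -/

section DiamondNorm

variable {ι : Type} [Fintype ι] [DecidableEq ι]

open scoped ComplexOrder in
lemma traceNorm_pos {A : Matrix ι ι ℂ} (hA : A ≠ 0) : 0 < traceNorm A := by
  have hH := Matrix.isHermitian_conjTranspose_mul_self A
  have heigen : ∀ i, 0 ≤ hH.eigenvalues i :=
    (Matrix.posSemidef_conjTranspose_mul_self A).eigenvalues_nonneg
  have hne : hH.eigenvalues ≠ 0 := fun h =>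
    hA (Matrix.conjTranspose_mul_self_eq_zero.1 (hH.eigenvalues_eq_zero_iff.1 h))
  obtain ⟨i, hi⟩ := Function.ne_iff.1 hne
  exact Finset.sum_pos' (fun j _ => Real.sqrt_nonneg _)
    ⟨i, Finset.mem_univ i, Real.sqrt_pos.2 ((heigen i).lt_of_ne' hi)⟩

open scoped ComplexOrder in
lemma traceNorm_le_sqrt_card_mul_trace (A : Matrix ι ι ℂ) :
    traceNorm A ≤ √(Fintype.card ι * (Aᴴ * A).trace.re) := by
  have hH := Matrix.isHermitian_conjTranspose_mul_self A
  have heigen : ∀ i, 0 ≤ hH.eigenvalues i :=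
    (Matrix.posSemidef_conjTranspose_mul_self A).eigenvalues_nonneg
  have hcauchy := sq_sum_le_card_mul_sum_sq (s := Finset.univ) (f := fun i => √(hH.eigenvalues i))
  simp only [Real.sq_sqrt (heigen _)] at hcauchy
  refine Real.le_sqrt_of_sq_le ?_
  rw [hH.trace_eq_sum_eigenvalues]
  simpa [traceNorm] using hcauchy

lemma exists_pos_traceNorm_smul_le_one (A : Matrix ι ι ℂ) :
    ∃ t : ℝ, 0 < t ∧ traceNorm ((t : ℂ) • A) ≤ 1 := by
  set C := √(Fintype.card ι * (Aᴴ * A).trace.re)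
  have hC0 : 0 < C + 1 := by positivity
  refine ⟨(C + 1)⁻¹, inv_pos.2 hC0, ?_⟩
  set t := (C + 1)⁻¹
  have ht : 0 ≤ t := (inv_pos.2 hC0).le
  have htrace : (((t : ℂ) • A)ᴴ * ((t : ℂ) • A)).trace.re = t ^ 2 * (Aᴴ * A).trace.re := by
    rw [Matrix.conjTranspose_smul, Matrix.smul_mul, Matrix.mul_smul, smul_smul, Matrix.trace_smul,
      RCLike.star_def, Complex.conj_ofReal, ← Complex.ofReal_mul, smul_eq_mul,
      Complex.re_ofReal_mul, sq]
  calc traceNorm ((t : ℂ) • A) ≤ √(t ^ 2 * (Fintype.card ι * (Aᴴ * A).trace.re)) := by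
        rw [mul_left_comm, ← htrace]
        exact traceNorm_le_sqrt_card_mul_trace _
    _ = (C + 1)⁻¹ * C := by rw [Real.sqrt_mul (sq_nonneg t), Real.sqrt_sq ht]
    _ ≤ 1 := (inv_mul_le_one₀ hC0).2 (le_add_of_nonneg_right zero_le_one)

lemma exists_pos_le_diamondNorm_of_apply_eq_self {M : Matrix ι ι ℂ} (hM : M ≠ 0) :
    ∃ δ > (0 : ℝ), ∀ Φ : Module.End ℂ (Matrix ι ι ℂ), Φ M = M →
      ENNReal.ofReal δ ≤ diamondNorm Φ := by
  let X : Matrix (ι × Fin 1) (ι × Fin 1) ℂ := M.submatrix Prod.fst Prod.fst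
  have hX : X ≠ 0 := fun h => hM (Matrix.ext fun x y => congrFun₂ h (x, 0) (y, 0))
  obtain ⟨t, ht, hle⟩ := exists_pos_traceNorm_smul_le_one X
  have htX : (t : ℂ) • X ≠ 0 := smul_ne_zero (Complex.ofReal_ne_zero.2 ht.ne') hX
  refine ⟨traceNorm ((t : ℂ) • X), traceNorm_pos htX, fun Φ hΦ => ?_⟩
  have hfix : ampliation Φ 1 ((t : ℂ) • X) = (t : ℂ) • X := by
    ext p q
    change Φ ((t : ℂ) • M) p.1 q.1 = ((t : ℂ) • M) p.1 q.1
    rw [map_smul, hΦ]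
  calc ENNReal.ofReal (traceNorm ((t : ℂ) • X))
      = ENNReal.ofReal (traceNorm (ampliation Φ 1 ((t : ℂ) • X))) := by rw [hfix]
    _ ≤ diamondNorm Φ := le_iSup_of_le 1 (le_iSup₂_of_le ((t : ℂ) • X) hle le_rfl)

end DiamondNorm

section Designs

variable {n d k : ℕ} {M : Matrix (Fin k → Idx n d) (Fin k → Idx n d) ℂ}

lemma twirl_pow_apply_eq_self {ν : Measure (SymU n d)} [IsProbabilityMeasure ν]
    (hM : ∀ᵐ U ∂ν, conjPow k U M = M) (s : ℕ) : (twirl ν k ^ s) M = M := by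
  have hone : twirl ν k M = M := by
    ext x y
    change ∫ U, conjPow k U M x y ∂ν = M x y
    rw [integral_congr_ae (hM.mono fun U hU => congrFun₂ hU x y), integral_const, probReal_univ,
      one_smul]
  rw [Module.End.pow_apply]
  exact Function.iterate_fixed hone s

lemma integral_monoidHom_eq_zero {G : Type*} [Group G] [MeasurableSpace G] [MeasurableMul G]
    {μ : Measure G} [μ.IsMulLeftInvariant] {χ : G →* ℂ} (hχ : ∃ g, χ g ≠ 1) :
    ∫ g, χ g ∂μ = 0 := by
  obtain ⟨g, hg⟩ := hχ
  have hinv : χ g * ∫ h, χ h ∂μ = ∫ h, χ h ∂μ := by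
    simpa only [map_mul, integral_const_mul] using integral_mul_left_eq_self (μ := μ) χ g
  by_contra hne
  exact hg ((mul_eq_right₀ hne).1 hinv)

instance (n d : ℕ) : (haarSym n d).IsMulLeftInvariant := by
  unfold haarSym
  infer_instance

lemma twirl_haarSym_eq_zero {χ : SymU n d →* ℂ} (hχ : ∃ U, χ U ≠ 1)
    (hM : ∀ U, conjPow k U M = χ U • M) : twirl (haarSym n d) k M = 0 := by
  ext x y
  change ∫ U, conjPow k U M x y ∂(haarSym n d) = 0
  simp only [hM, Matrix.smul_apply, smul_eq_mul]
  rw [integral_mul_const, integral_monoidHom_eq_zero hχ, zero_mul]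

lemma noLargeDesigns_of_hasTensorWeight {γ : ℕ} [Nonempty (Idx n d)] {χ : SymU n d →* ℂ}
    (hlocal : localGroup n d γ ≤ χ.ker) (hχ : ∃ U, χ U ≠ 1)
    (hweight : ∃ k₀, ∀ k ≥ k₀, HasTensorWeight SymU.mat k k χ) : NoLargeDesigns n d γ := by
  obtain ⟨k₀, hk₀⟩ := hweight
  refine ⟨k₀, fun k hk => ?_⟩
  obtain ⟨M, hM, hMχ⟩ := hk₀ k hk
  obtain ⟨δ, hδ, hdiamond⟩ := exists_pos_le_diamondNorm_of_apply_eq_self hM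
  have hdim : (0 : ℝ) < ((d : ℝ) ^ n) ^ k := by
    have hcard : 0 < Fintype.card (Idx n d) := Fintype.card_pos
    rw [Fintype.card_fun, Fintype.card_fin, Fintype.card_fin] at hcard
    exact pow_pos (by exact_mod_cast hcard) k
  refine ⟨δ / 2 * ((d : ℝ) ^ n) ^ k, by positivity, fun ν _ hν s hdesign => ?_⟩
  have hfix : ∀ᵐ U ∂ν, conjPow k U M = M := hν.mono fun U hU => by
    rw [conjPow, hMχ, MonoidHom.mem_ker.1 (hlocal hU), one_smul]
  have hdist : (twirl ν k ^ s - twirl (haarSym n d) k) M = M := by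
    rw [LinearMap.sub_apply, twirl_pow_apply_eq_self hfix, twirl_haarSym_eq_zero hχ hMχ, sub_zero]
  have hle := (hdiamond _ hdist).trans hdesign
  rw [mul_div_cancel_right₀ _ hdim.ne', ENNReal.ofReal_le_ofReal_iff (half_pos hδ).le] at hle
  exact hle.not_gt (half_lt_self hδ)

end Designs

/-! ### Relative phases from class sums -/

section PermMat

variable {n d : ℕ}

/-- The matrix of a permutation of the qudits, as a permutation matrix on the set of words. -/
def permMat (d : ℕ) (σ : Equiv.Perm (Fin n)) : Matrix (Idx n d) (Idx n d) ℂ :=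
  Equiv.Perm.permMatrix ℂ (σ⁻¹.arrowCongr (Equiv.refl (Fin d)))

lemma permMat_mulVec (σ : Equiv.Perm (Fin n)) (v : Idx n d → ℂ) :
    permMat d σ *ᵥ v = permRep n d σ v :=
  Matrix.permMatrix_mulVec _

lemma commute_permMat_iff {σ : Equiv.Perm (Fin n)} {A : Matrix (Idx n d) (Idx n d) ℂ} :
    Commute A (permMat d σ) ↔ ∀ x y : Idx n d, A (x ∘ σ) (y ∘ σ) = A x y :=
  commute_permMatrix_iff

lemma commute_tensorPow_permMat (V : Matrix (Fin d) (Fin d) ℂ) (σ : Equiv.Perm (Fin n)) :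
    Commute (tensorPow n V) (permMat d σ) :=
  commute_permMat_iff.2 fun x y => Equiv.prod_comp σ fun i => V (x i) (y i)

lemma conjTranspose_permMat (σ : Equiv.Perm (Fin n)) : (permMat d σ)ᴴ = permMat d σ⁻¹ :=
  Matrix.conjTranspose_permMatrix _

lemma permMat_apply_self (σ : Equiv.Perm (Fin n)) (x : Idx n d) :
    permMat d σ x x = if x ∘ σ = x then 1 else 0 := by
  simp only [permMat, Equiv.Perm.permMatrix, PEquiv.toMatrix_apply, Equiv.toPEquiv_apply,
    Option.mem_some_iff]
  rfl

lemma sum_mul_permMat_apply_self (m : WordClass (Fin n) (Fin d) → ℤ) (σ : Equiv.Perm (Fin n)) :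
    ∑ x, (m (cls x) : ℂ) * permMat d σ x x = fixedWeight m σ := by
  simp only [permMat_apply_self, mul_ite, mul_one, mul_zero, fixedWeight, Int.cast_sum,
    ← Finset.sum_filter]

/-- The operator on the qudits given by the sum `∑ g, g σ g⁻¹`, a multiple of the sum over the
conjugacy class of `σ`. -/
def classSum (d : ℕ) (σ : Equiv.Perm (Fin n)) : Matrix (Idx n d) (Idx n d) ℂ :=
  ∑ g, permMat d (g * σ * g⁻¹)

lemma isHermitian_classSum (σ : Equiv.Perm (Fin n)) : (classSum d σ).IsHermitian := by
  obtain ⟨h, hσ⟩ : IsConj σ σ⁻¹ :=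
    Equiv.Perm.isConj_iff_cycleType_eq.2 (Equiv.Perm.cycleType_inv σ).symm
  rw [Matrix.IsHermitian, classSum, Matrix.conjTranspose_sum]
  refine Fintype.sum_equiv (Equiv.mulRight (h : Equiv.Perm (Fin n))) _ _ fun g => ?_
  have hσ' : σ⁻¹ = h * σ * (h : Equiv.Perm (Fin n))⁻¹ := eq_mul_inv_of_mul_eq hσ.eq.symm
  rw [conjTranspose_permMat, mul_inv_rev, mul_inv_rev, inv_inv, hσ', Equiv.coe_mulRight]
  simp only [mul_assoc, mul_inv_rev]

lemma isSymmetric_classSum (σ : Equiv.Perm (Fin n)) : IsSymmetric (classSum d σ) :=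
  fun V _ => Commute.sum_left _ _ _ fun _ _ => (commute_tensorPow_permMat V _).symm

lemma sum_mul_classSum_apply_self (m : WordClass (Fin n) (Fin d) → ℤ) (σ : Equiv.Perm (Fin n)) :
    ∑ x, (m (cls x) : ℂ) * classSum d σ x x = n.factorial * fixedWeight m σ := by
  simp only [classSum, Matrix.sum_apply, Finset.mul_sum]
  rw [Finset.sum_comm]
  simp only [sum_mul_permMat_apply_self, fixedWeight_conj, Finset.sum_const, Finset.card_univ,
    Fintype.card_perm, Fintype.card_fin, nsmul_eq_mul]

end PermMat

lemma sum_of_conj_mem_center {k G : Type*} [CommSemiring k] [Group G] [Fintype G] (σ : G) :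
    ∑ g, MonoidAlgebra.of k G (g * σ * g⁻¹) ∈ Set.center (MonoidAlgebra k G) := by
  rw [Semigroup.mem_center_iff]
  intro a
  induction a using MonoidAlgebra.induction_on with
  | of h =>
    rw [Finset.mul_sum, Finset.sum_mul]
    refine Fintype.sum_equiv (Equiv.mulLeft h) _ _ fun g => ?_
    rw [← map_mul, ← map_mul, Equiv.coe_mulLeft]
    congr 1
    group
  | add a b ha hb => rw [add_mul, mul_add, ha, hb]
  | smul r a ha => rw [smul_mul_assoc, mul_smul_comm, ha]

section Center

variable (k : Type*) {R M : Type*} [Field k] [IsAlgClosed k] [Ring R] [Algebra k R]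
  [AddCommGroup M] [Module k M] [Module R M] [IsScalarTower k R M] [FiniteDimensional k M]

lemma exists_smul_eq_smul_of_mem_isotypicComponent {z : R} (hz : z ∈ Set.center R)
    (S : Submodule R M) [IsSimpleModule R S] :
    ∃ κ : k, ∀ v ∈ isotypicComponent R M S, z • v = κ • v := by
  have : FiniteDimensional k S :=
    FiniteDimensional.finiteDimensional_submodule (S.restrictScalars k)
  obtain ⟨κ, hκ⟩ := (IsSimpleModule.algebraMap_end_bijective_of_isAlgClosed k).2
    (Module.End.smulLeft z hz : Module.End R S)
  have hle : isotypicComponent R M S ≤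
      LinearMap.eqLocus (Module.End.smulLeft z hz) (algebraMap k (Module.End R M) κ) := by
    refine sSup_le fun N ⟨e⟩ v hv => ?_
    have hN : z • (⟨v, hv⟩ : N) = κ • (⟨v, hv⟩ : N) := e.injective <| by
      rw [map_smul]
      exact (LinearMap.congr_fun hκ _).symm.trans
        (LinearMap.map_smul_of_tower e.toLinearMap κ _).symm
    exact congrArg Subtype.val hN
  exact ⟨κ, fun v hv => hle hv⟩

end Center

lemma exists_classSum_mulVec_eq_smul {n d : ℕ} (σ : Equiv.Perm (Fin n))
    {C : Submodule (MonoidAlgebra ℂ (Equiv.Perm (Fin n))) (permRep n d).asModule}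
    (hC : C ∈ sectors n d) : ∃ κ : ℂ, ∀ v ∈ C,
      classSum d σ *ᵥ (permRep n d).asModuleEquiv v = κ • (permRep n d).asModuleEquiv v := by
  obtain ⟨S, hS, rfl⟩ := hC
  obtain ⟨κ, hκ⟩ := exists_smul_eq_smul_of_mem_isotypicComponent ℂ
    (sum_of_conj_mem_center (k := ℂ) σ) S
  refine ⟨κ, fun v hv => ?_⟩
  calc classSum d σ *ᵥ (permRep n d).asModuleEquiv v
      = (permRep n d).asModuleEquiv ((∑ g, MonoidAlgebra.of ℂ _ (g * σ * g⁻¹)) • v) := by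
        simp only [Representation.asModuleEquiv_map_smul, map_sum, classSum, Matrix.sum_mulVec,
          LinearMap.sum_apply, Representation.asAlgebraHom_of, permMat_mulVec]
    _ = κ • (permRep n d).asModuleEquiv v := congrArg _ (hκ v hv)

open scoped Matrix.Norms.Operator in
lemma exp_mulVec_of_mulVec_eq_smul {ι : Type*} [Fintype ι] [DecidableEq ι] {A : Matrix ι ι ℂ}
    {v : ι → ℂ} {a : ℂ} (h : A *ᵥ v = a • v) :
    NormedSpace.exp A *ᵥ v = Complex.exp a • v := by
  have hsemi : SemiconjBy (Matrix.vecMulVec v 1) (Matrix.diagonal fun _ => a) A := by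
    rw [SemiconjBy, Matrix.mul_vecMulVec, h]
    ext x y
    simp [Matrix.vecMulVec_apply, mul_comm]
  have hexp : Matrix.vecMulVec v 1 * NormedSpace.exp (Matrix.diagonal fun _ => a) =
      NormedSpace.exp A * Matrix.vecMulVec v 1 := hsemi.exp_right.eq
  ext x
  have hx := congrFun₂ hexp x x
  rw [Matrix.exp_diagonal, Matrix.mul_vecMulVec, Matrix.mul_diagonal, Pi.coe_exp,
    ← Complex.exp_eq_exp_ℂ] at hx
  simpa [Matrix.vecMulVec_apply, mul_comm] using hx.symm

lemma exp_mem_unitaryGroup_of_isHermitian {ι : Type*} [Fintype ι] [DecidableEq ι]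
    {H : Matrix ι ι ℂ} (hH : H.IsHermitian) :
    NormedSpace.exp ((-Complex.I) • H) ∈ Matrix.unitaryGroup ι ℂ := by
  have hcomm : Commute ((-Complex.I) • H) ((-Complex.I) • H)ᴴ := by
    rw [Matrix.conjTranspose_smul, hH.eq]
    exact ((Commute.refl H).smul_left _).smul_right _
  rw [Matrix.mem_unitaryGroup_iff, Matrix.star_eq_conjTranspose, ← Matrix.exp_conjTranspose,
    ← Matrix.exp_add_of_commute _ _ hcomm, Matrix.conjTranspose_smul, hH.eq]
  simp

section RelativePhase

variable {n d : ℕ}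

lemma exists_mat_eq_exp {H : Matrix (Idx n d) (Idx n d) ℂ} (hH : H.IsHermitian)
    (hsym : IsSymmetric H) : ∃ U : SymU n d, U.mat = NormedSpace.exp ((-Complex.I) • H) :=
  ⟨⟨⟨_, exp_mem_unitaryGroup_of_isHermitian hH⟩,
    fun V hV => ((hsym V hV).smul_left _).exp_left⟩, rfl⟩

lemma isRelativePhase_of_mat_eq_exp_classSum {U : SymU n d} {σ : Equiv.Perm (Fin n)} {z : ℂ}
    (hU : U.mat = NormedSpace.exp (z • classSum d σ)) : IsRelativePhase U := by
  intro C hC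
  obtain ⟨κ, hκ⟩ := exists_classSum_mulVec_eq_smul σ hC
  refine ⟨Complex.exp (z * κ), fun v hv => hU ▸ exp_mulVec_of_mulVec_eq_smul ?_⟩
  rw [Matrix.smul_mulVec, hκ v hv, smul_smul]

lemma exists_isRelativePhase_weightHom_ne_one {m : WordClass (Fin n) (Fin d) → ℤ} (hm : m ≠ 0) :
    ∃ U : SymU n d, IsRelativePhase U ∧ weightHom m U ≠ 1 := by
  obtain ⟨σ, hσ⟩ := exists_fixedWeight_ne_zero hm
  set r : ℝ := n.factorial * fixedWeight m σ
  have hr0 : r ≠ 0 := mul_ne_zero (Nat.cast_ne_zero.2 n.factorial_ne_zero) (Int.cast_ne_zero.2 hσ)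
  -- The time `π / r` makes the character take the value `exp (-iπ)`.
  let H : Matrix (Idx n d) (Idx n d) ℂ := ((Real.pi / r : ℝ) : ℂ) • classSum d σ
  have hH : H.IsHermitian := (isHermitian_classSum σ).smul (Complex.conj_ofReal _)
  have hsym : IsSymmetric H := fun V hV => (isSymmetric_classSum σ V hV).smul_left _
  obtain ⟨U, hU⟩ := exists_mat_eq_exp hH hsym
  refine ⟨U, isRelativePhase_of_mat_eq_exp_classSum (hU.trans (by rw [smul_smul])), ?_⟩
  have hsum : ∑ x, (m (cls x) : ℂ) * H x x = Real.pi := by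
    simp only [H, Matrix.smul_apply, smul_eq_mul, mul_left_comm _ ((Real.pi / r : ℝ) : ℂ)]
    rw [← Finset.mul_sum, sum_mul_classSum_apply_self]
    rw [← Complex.ofReal_natCast, ← Complex.ofReal_intCast, ← Complex.ofReal_mul,
      ← Complex.ofReal_mul, div_mul_cancel₀ _ hr0]
  rw [weightHom_of_mat_eq_exp m hH hsym hU, hsum, neg_mul, Complex.exp_neg, mul_comm,
    Complex.exp_pi_mul_I]
  norm_num

end RelativePhase

/-! ### Counting the charge sectors -/

lemma ncard_isotypicComponents_le_finrank {k R M V : Type*} [Field k] [Ring R] [Algebra k R]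
    [AddCommGroup M] [Module k M] [Module R M] [IsScalarTower k R M] [IsSemisimpleModule R M]
    [Finite (isotypicComponents R M)] [AddCommGroup V] [Module k V] [FiniteDimensional k V]
    (f : Module.End R M →ₗ[k] V)
    (hf : ∀ φ ∈ Subalgebra.center k (Module.End R M), f φ = 0 → φ = 0) :
    (isotypicComponents R M).ncard ≤ Module.finrank k V := by
  classical
  have := Fintype.ofFinite (isotypicComponents R M)
  let e := IsSemisimpleModule.endAlgEquiv k R M
  let scalars : (isotypicComponents R M → k) →ₗ[k]
      ∀ c : isotypicComponents R M, Module.End R c.1 :=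
    LinearMap.pi fun c => Algebra.linearMap k (Module.End R c.1) ∘ₗ LinearMap.proj c
  have hcenter : ∀ a, e.symm (scalars a) ∈ Subalgebra.center k (Module.End R M) := fun a =>
    Subalgebra.mem_center_iff.2 fun φ => e.injective <| by
      rw [map_mul, map_mul, e.apply_symm_apply]
      exact funext fun c => (Algebra.commutes (a c) (e φ c)).symm
  have hscalars : ∀ a, scalars a = 0 → a = 0 := fun a ha => funext fun c => by
    have : Nontrivial c.1 :=
      Submodule.nontrivial_iff_ne_bot.2 (bot_lt_isotypicComponents c.2).ne'
    exact (map_eq_zero_iff _ (FaithfulSMul.algebraMap_injective k (Module.End R c.1))).1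
      (congrFun ha c)
  have hinj : Function.Injective (f ∘ₗ e.symm.toLinearMap ∘ₗ scalars) :=
    (injective_iff_map_eq_zero _).2 fun a ha =>
      hscalars a ((map_eq_zero_iff _ e.symm.injective).1 (hf _ (hcenter a) ha))
  calc (isotypicComponents R M).ncard = Module.finrank k (isotypicComponents R M → k) := by
        rw [Module.finrank_fintype_fun_eq_card, ← Nat.card_eq_fintype_card, Nat.card_coe_set_eq]
    _ ≤ Module.finrank k V := LinearMap.finrank_le_finrank_of_injective hinj

section Polarization

open ComplexStarModule in
lemma eq_zero_of_eval_isHermitian_eq_zero {ι : Type*} {Q : MvPolynomial (ι × ι) ℂ}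
    (hQ : ∀ H : Matrix ι ι ℂ, H.IsHermitian → MvPolynomial.eval (Function.uncurry H) Q = 0) :
    Q = 0 := by
  refine MvPolynomial.funext fun v => ?_
  rw [map_zero]
  -- `Q` vanishes at `ℜ V + t ℑ V` for all real `t`, hence also for `t = i`.
  let V : Matrix ι ι ℂ := Function.curry v
  let p : Polynomial ℂ := MvPolynomial.aeval (fun ij : ι × ι =>
    Polynomial.C ((ℜ V : Matrix ι ι ℂ) ij.1 ij.2) +
      Polynomial.X * Polynomial.C ((ℑ V : Matrix ι ι ℂ) ij.1 ij.2)) Q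
  have hp : ∀ t : ℂ, p.eval t =
      MvPolynomial.eval (Function.uncurry ((ℜ V : Matrix ι ι ℂ) + t • (ℑ V : Matrix ι ι ℂ))) Q := by
    intro t
    simp only [p, MvPolynomial.aeval_def, ← Polynomial.coe_evalRingHom, MvPolynomial.hom_eval₂]
    rw [MvPolynomial.eval, MvPolynomial.coe_eval₂Hom]
    congr 1
    · ext a
      simp
    · ext ij
      simp [Function.uncurry, mul_comm t]
  have hp0 : p = 0 := by
    refine Polynomial.eq_zero_of_infinite_isRoot p
      ((Set.infinite_range_of_injective Complex.ofReal_injective).mono ?_)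
    rintro _ ⟨t, rfl⟩
    refine (hp t).trans (hQ _ ?_)
    exact (ℜ V).2.add (.smul (Complex.conj_ofReal t) (ℑ V).2)
  have hI := hp Complex.I
  rw [hp0, Polynomial.eval_zero, realPart_add_I_smul_imaginaryPart] at hI
  exact hI.symm

variable {n d : ℕ} {Z : Matrix (Idx n d) (Idx n d) ℂ}

/-- The polynomial `V ↦ tr (Z V^{⊗ n})` in the matrix entries of `V`. -/
def tracePolynomial (Z : Matrix (Idx n d) (Idx n d) ℂ) : MvPolynomial (Fin d × Fin d) ℂ :=
  ∑ x, ∑ y, MvPolynomial.monomial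
    (Finsupp.equivFunOnFinite.symm (letterCount fun i => (y i, x i))) (Z x y)

lemma eval_tracePolynomial (Z : Matrix (Idx n d) (Idx n d) ℂ) (V : Matrix (Fin d) (Fin d) ℂ) :
    MvPolynomial.eval (Function.uncurry V) (tracePolynomial Z) = (Z * tensorPow n V).trace := by
  simp only [tracePolynomial, map_sum, MvPolynomial.eval_monomial, Matrix.trace, Matrix.diag_apply,
    Matrix.mul_apply]
  refine Finset.sum_congr rfl fun x _ => Finset.sum_congr rfl fun y _ => congrArg _ ?_
  rw [Finsupp.prod_fintype _ _ fun _ => pow_zero _]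
  simp only [Finsupp.equivFunOnFinite_symm_apply_apply, letterCount, tensorPow, Matrix.of_apply]
  refine (Fintype.prod_congr _ _ fun p => ?_).trans
    (Fintype.prod_fiberwise' (fun i => (y i, x i)) (Function.uncurry V))
  exact (Finset.prod_const _).symm

lemma eq_zero_of_tracePolynomial_eq_zero
    (hZ : ∀ σ : Equiv.Perm (Fin n), Commute Z (permMat d σ)) (h : tracePolynomial Z = 0) :
    Z = 0 := by
  have hcount : ∀ {x y x' y' : Idx n d},
      letterCount (fun i => (y' i, x' i)) = letterCount (fun i => (y i, x i)) →
        Z x' y' = Z x y := by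
    intro x y x' y' hxy
    obtain ⟨σ, hσ⟩ := exists_perm_comp_eq (congrFun hxy)
    have hy : y ∘ σ = y' := funext fun i => congrArg Prod.fst (congrFun hσ i)
    have hx : x ∘ σ = x' := funext fun i => congrArg Prod.snd (congrFun hσ i)
    rw [← hx, ← hy, commute_permMat_iff.1 (hZ σ)]
  ext x y
  let N : Finset (Idx n d × Idx n d) :=
    {q | letterCount (fun i => (q.2 i, q.1 i)) = letterCount (fun i => (y i, x i))}
  have hN : N.Nonempty := ⟨(x, y), by simp [N]⟩
  have hcoeff : (N.card : ℂ) * Z x y = 0 := by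
    rw [← MvPolynomial.coeff_zero (Finsupp.equivFunOnFinite.symm (letterCount fun i => (y i, x i))),
      ← h]
    simp only [tracePolynomial, MvPolynomial.coeff_sum, MvPolynomial.coeff_monomial,
      EmbeddingLike.apply_eq_iff_eq]
    rw [← Fintype.sum_prod_type', ← Finset.sum_filter, Finset.sum_congr rfl fun q hq =>
      hcount (Finset.mem_filter.1 hq).2, Finset.sum_const, nsmul_eq_mul]
  exact (mul_eq_zero.1 hcoeff).resolve_left (Nat.cast_ne_zero.2 hN.card_ne_zero)

lemma trace_mul_tensorPow_eq_zero_of_isHermitian (hZ : ∀ V, Commute Z (tensorPow n V))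
    (hdiag : ∀ x, Z x x = 0) {V : Matrix (Fin d) (Fin d) ℂ} (hV : V.IsHermitian) :
    (Z * tensorPow n V).trace = 0 := by
  let W : Matrix (Fin d) (Fin d) ℂ := hV.eigenvectorUnitary
  have hWW : tensorPow n (star W) * tensorPow n W = 1 := by
    rw [← tensorPow_mul, Unitary.coe_star_mul_self, tensorPow_one]
  rw [hV.spectral_theorem, Unitary.conjStarAlgAut_apply, tensorPow_mul, tensorPow_mul,
    tensorPow_diagonal]
  set D := Matrix.diagonal fun x : Idx n d => ∏ i, ((RCLike.ofReal ∘ hV.eigenvalues) (x i) : ℂ)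
  calc (Z * (tensorPow n W * D * tensorPow n (star W))).trace
      = (tensorPow n (star W) * (Z * tensorPow n W * D)).trace := by
        rw [← mul_assoc, ← mul_assoc, Matrix.trace_mul_comm]
    _ = (Z * D).trace := by
        rw [← mul_assoc, ← mul_assoc, ← (hZ _).eq, mul_assoc Z, hWW, mul_one]
    _ = 0 := by simp [D, Matrix.trace, Matrix.mul_diagonal, hdiag]

lemma eq_zero_of_diag_eq_zero (hperm : ∀ σ : Equiv.Perm (Fin n), Commute Z (permMat d σ))
    (htensor : ∀ V, Commute Z (tensorPow n V)) (hdiag : ∀ x, Z x x = 0) : Z = 0 := by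
  refine eq_zero_of_tracePolynomial_eq_zero hperm
    (eq_zero_of_eval_isHermitian_eq_zero fun V hV => ?_)
  rw [eval_tracePolynomial]
  exact trace_mul_tensorPow_eq_zero_of_isHermitian htensor hdiag hV

lemma tensorPow_permMatrix (n : ℕ) (π : Equiv.Perm (Fin d)) :
    tensorPow n (π.permMatrix ℂ) =
      Equiv.Perm.permMatrix ℂ ((Equiv.refl (Fin n)).arrowCongr π) := by
  ext x y
  simp [tensorPow, PEquiv.toMatrix_apply, funext_iff, Finset.prod_boole]

lemma diag_eq_of_cls_eq (hperm : ∀ σ : Equiv.Perm (Fin n), Commute Z (permMat d σ))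
    (htensor : ∀ V, Commute Z (tensorPow n V)) {x y : Idx n d} (hxy : cls x = cls y) :
    Z x x = Z y y := by
  obtain ⟨π, σ, rfl⟩ := cls_eq_cls.1 hxy
  have hπ := commute_permMatrix_iff.1 (tensorPow_permMatrix n π ▸ htensor (π.permMatrix ℂ))
  exact ((hπ (x ∘ σ) (x ∘ σ)).trans (commute_permMat_iff.1 (hperm σ) x x)).symm

end Polarization

section EndMat

variable {n d : ℕ}

/-- The algebra homomorphism sending an endomorphism of the `S_n`-module of `n` qudits to its
matrix. -/
def endMat (n d : ℕ) :
    Module.End (MonoidAlgebra ℂ (Equiv.Perm (Fin n))) (permRep n d).asModule →ₐ[ℂ]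
      Matrix (Idx n d) (Idx n d) ℂ :=
  AlgHom.ofLinearMap
    (LinearMap.toMatrix'.toLinearMap ∘ₗ Representation.IntertwiningMap.toLinearMapl _ _ ∘ₗ
      (Representation.IntertwiningMap.equivAlgEnd (permRep n d)).symm.toLinearMap)
    LinearMap.toMatrix'_one fun φ ψ => (LinearMap.toMatrix'_mul
      ((Representation.IntertwiningMap.equivAlgEnd (permRep n d)).symm φ).toLinearMap
      ((Representation.IntertwiningMap.equivAlgEnd (permRep n d)).symm ψ).toLinearMap)

lemma endMat_injective : Function.Injective (endMat n d) :=
  LinearMap.toMatrix'.injective.comp <|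
    (Representation.IntertwiningMap.toLinearMap_injective _ _).comp
      (Representation.IntertwiningMap.equivAlgEnd (permRep n d)).symm.injective

lemma permMat_eq_toMatrix' (σ : Equiv.Perm (Fin n)) :
    permMat d σ = LinearMap.toMatrix' (permRep n d σ) := by
  rw [← LinearMap.toMatrix'_toLin' (permMat d σ)]
  exact congrArg _ (LinearMap.ext (permMat_mulVec σ))

lemma mem_range_endMat_iff {A : Matrix (Idx n d) (Idx n d) ℂ} :
    A ∈ (endMat n d).range ↔ ∀ σ : Equiv.Perm (Fin n), Commute A (permMat d σ) := by
  simp only [permMat_eq_toMatrix']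
  refine ⟨?_, fun hA => ?_⟩
  · rintro ⟨φ, rfl⟩ σ
    let f := (Representation.IntertwiningMap.equivAlgEnd (permRep n d)).symm φ
    have hf : f.toLinearMap * permRep n d σ = permRep n d σ * f.toLinearMap :=
      f.isIntertwining' σ
    exact Commute.map hf LinearMap.toMatrixAlgEquiv'
  · refine ⟨Representation.IntertwiningMap.equivAlgEnd (permRep n d)
      { toLinearMap := Matrix.toLin' A
        isIntertwining' := fun σ => LinearMap.toMatrix'.injective ?_ }, ?_⟩
    · rw [LinearMap.toMatrix'_comp, LinearMap.toMatrix'_comp, LinearMap.toMatrix'_toLin']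
      exact hA σ
    · exact LinearMap.toMatrix'_toLin' A

end EndMat

lemma numSectors_le_card_wordClass (n d : ℕ) :
    numSectors n d ≤ Fintype.card (WordClass (Fin n) (Fin d)) := by
  have : IsNoetherian (MonoidAlgebra ℂ (Equiv.Perm (Fin n))) (permRep n d).asModule :=
    isNoetherian_of_tower ℂ inferInstance
  let rep : WordClass (Fin n) (Fin d) → Idx n d := Function.surjInv cls_surjective
  let diag := LinearMap.funLeft ℂ ℂ rep ∘ₗ Matrix.diagLinearMap (Idx n d) ℂ ℂ ∘ₗ
    (endMat n d).toLinearMap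
  refine (ncard_isotypicComponents_le_finrank diag fun φ hφ hdiag => ?_).trans_eq
    (Module.finrank_fintype_fun_eq_card ℂ)
  have hperm := mem_range_endMat_iff.1 ((endMat n d).mem_range_self φ)
  have htensor : ∀ V, Commute (endMat n d φ) (tensorPow n V) := fun V => by
    obtain ⟨ψ, hψ⟩ := mem_range_endMat_iff.2 (commute_tensorPow_permMat V)
    have hcomm : Commute φ ψ := (Subalgebra.mem_center_iff.1 hφ ψ).symm
    exact hψ ▸ hcomm.map (endMat n d)
  have hzero : endMat n d φ = 0 := eq_zero_of_diag_eq_zero hperm htensor fun x =>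
    (diag_eq_of_cls_eq hperm htensor (Function.surjInv_eq cls_surjective (cls x)).symm).trans
      (congrFun hdiag (cls x))
  exact endMat_injective (hzero.trans (map_zero _).symm)

/-! ### Small locality -/

lemma log_le_of_le_two_pow {p γ : ℕ} (h : p ≤ 2 ^ γ) : Real.log p ≤ γ := by
  rcases p.eq_zero_or_pos with rfl | hp
  · simp
  · calc Real.log p ≤ Real.log (2 ^ γ) :=
          Real.log_le_log (Nat.cast_pos.2 hp) (by exact_mod_cast h)
      _ = γ * Real.log 2 := Real.log_pow 2 γ
      _ ≤ γ := mul_le_of_le_one_right γ.cast_nonneg (by linarith [Real.log_two_lt_d9])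

variable {n d γ : ℕ}

lemma two_pow_lt_card_wordClass_of_lt_log (h : (γ : ℝ) < Real.log (numSectors n d)) :
    2 ^ γ < Fintype.card (WordClass (Fin n) (Fin d)) :=
  (not_le.1 (mt log_le_of_le_two_pow h.not_ge)).trans_le (numSectors_le_card_wordClass n d)

lemma exists_isRelativePhase_notMem_localGroup
    (h : 2 ^ γ < Fintype.card (WordClass (Fin n) (Fin d))) :
    ∃ U : SymU n d, IsRelativePhase U ∧ U ∉ localGroup n d γ := by
  obtain ⟨m, hm0, hm⟩ := exists_isBalanced_ne_zero h
  obtain ⟨U, hU, hχ⟩ := exists_isRelativePhase_weightHom_ne_one hm0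
  exact ⟨U, hU, fun hlocal => hχ (hm.localGroup_le_ker hlocal)⟩

lemma noLargeDesigns_of_two_pow_lt (h : 2 ^ γ < Fintype.card (WordClass (Fin n) (Fin d))) :
    NoLargeDesigns n d γ := by
  obtain ⟨m, hm0, hm⟩ := exists_isBalanced_ne_zero h
  obtain ⟨U, -, hχ⟩ := exists_isRelativePhase_weightHom_ne_one hm0
  have : Nonempty (Idx n d) := (Function.ne_iff.1 hm0).nonempty.elim
    fun c => ⟨(cls_surjective c).choose⟩
  exact noLargeDesigns_of_hasTensorWeight hm.localGroup_le_ker ⟨U, hχ⟩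
    (exists_hasTensorWeight_weightHom hm.sum_eq_zero)

end SymDesign

end

theorem theorem1 :
    (∃ c > (0 : ℝ), ∀ n d γ : ℕ,
      ((∀ U : SymU n d, IsRelativePhase U → U ∈ localGroup n d γ) →
        c * Real.log (numSectors n d) ≤ γ) ∧
      ((γ : ℝ) < c * Real.log (numSectors n d) → NoLargeDesigns n d γ)) ∧
    (∀ d ≥ 2, ∀ γ : ℕ, ∃ n₀ : ℕ, ∀ n ≥ n₀, NoLargeDesigns n d γ) := by
  refine ⟨⟨1, one_pos, fun n d γ => ⟨fun hall => ?_, fun hγ => ?_⟩⟩, fun d hd γ =>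
    ⟨2 * 2 ^ γ, fun n hn => ?_⟩⟩
  · rw [one_mul]
    by_contra! hγ
    obtain ⟨U, hU, hlocal⟩ :=
      exists_isRelativePhase_notMem_localGroup (two_pow_lt_card_wordClass_of_lt_log hγ)
    exact hlocal (hall U hU)
  · rw [one_mul] at hγ
    exact noLargeDesigns_of_two_pow_lt (two_pow_lt_card_wordClass_of_lt_log hγ)
  · have : Nontrivial (Fin d) := Fin.nontrivial_iff_two_le.2 hd
    refine noLargeDesigns_of_two_pow_lt (lt_of_le_of_lt ?_ half_card_lt_card_wordClass)
    rw [Fintype.card_fin, Nat.le_div_iff_mul_le two_pos]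
    omega
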